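/- **Setting.** $N\ge 1$ agents act in rounds $t=1,2,\dots$. Agent $i$ has a deterministic local cost $f_{i,t}:\mathbb R^d\to\mathbb R$, which is convex, differentiable and $L$-smooth ($\|\nabla f_{i,t}(x)-\nabla f_{i,t}(y)\|\le L\|x-y\|$). Put $f_t=\sum_{i=1}^N f_{i,t}$, let $x_t^*$ be a minimizer of $f_t$ over $\mathbb R^d$, and let $C_T=\sum_{t=2}^T\|x_t^*-x_{t-1}^*\|$. *Network.* At time $t$, agent $i$ can receive a message from $j$ iff $(i,j)\in\mathcal E_t$. There are $w\in(0,1)$ and an integer $B\ge1$ such that for all $t\ge 1$ the weight matrix $W_t$ is doubly stochastic, $[W_t]_{ij}\ge w$ if $(i,j)\in\mathcal E_t$ or $i=j$ and $[W_t]_{ij}=0$ otherwise, and the directed graph with edge set $\mathcal E_t\cup\dots\cup\mathcal E_{t+B-1}$ is strongly connected. *Algorithm.* From deterministic initial states $x_{i,1}$, $$x_{i,t+1}=\sum_{j=1}^N[W_t]_{ij}x_{j,t}-\eta_t\,\mathrm{clip}_{\lambda_t}\big(\widehat\nabla f_{i,t}(x_{i,t})\big),\qquad \mathrm{clip}_{\lambda}(y)=\min\{1,\lambda/\|y\|\}\,y,$$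 where $\widehat\nabla f_{i,t}$ is a random noisy gradient, $\lambda_t=2B_gt^{\alpha}$, $\eta_t=(at+b)^{-\kappa}$, with $a>0$, $a+b>0$, and $$\kappa=\frac{p+1}{2p},\qquad \alpha=\frac1{2p}.$$ *Noise and boundedness.* Let $\mathcal F_t$ be the $\sigma$-field generated by the noisy gradients $\widehat\nabla f_{j,s}(x_{j,s})$, $j\in[N]$, $s<t$. For some $p\in(1,2]$ and $\sigma>0$, for all $i,t$, almost surely $\mathbb E[\widehat\nabla f_{i,t}(x_{i,t})\mid\mathcal F_t]=\nabla f_{i,t}(x_{i,t})$ and $\mathbb E[\|\widehat\nabla f_{i,t}(x_{i,t})-\nabla f_{i,t}(x_{i,t})\|^p\mid\mathcal F_t]\le\sigma^p$. For some $B_X,B_g>0$, for all $i,t$, almost surely $\|x_{i,t}\|\le B_X$, $\|\nabla f_{i,t}(x_{i,t})\|\le B_g$ and $\|\nabla f_{i,t}(\bar x_t)\|\le B_g$, where $\bar x_t=\frac1N\sum_i x_{i,t}$. The dynamic regret is $\mathbf{REG}_T^d=\sum_{i=1}^N\sum_{t=1}^T\big(f_t(x_{i,t})-f_t(x_t^*)\big)$.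 **Corollary 1.** (1) There is a constant $C>0$, depending only on $N,B,w,p,\sigma,L,B_X,B_g,a,b$ and on a bound $R$ for $\max_i\|x_{i,1}-x_1^*\|$, such that for every $T\ge1$, whenever the assumptions hold in the rounds $1,\dots,T$ (and the network assumption for all $t\ge1$), and for every $\delta\in(0,1)$, with probability at least $1-\delta$, $$\mathbf{REG}_T^d\le C\,T^{\frac{1+p}{2p}}\Big(1+C_T+\log\frac1\delta\Big).$$ (2) Consequently, if the assumptions hold in all rounds $t\ge1$, with the same constants, and $\lim_{T\to\infty}C_T/T^{\frac{p-1}{2p}}=0$, then the regret is sublinear with high probability: for every $\delta\in(0,1)$ there are deterministic bounds $b_T$ with $b_T/T\to0$ such that, for every $T\ge1$, $\mathbf{REG}_T^d\le b_T$ with probability at least $1-\delta$. -/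

import Mathlib

open MeasureTheory Filter Topology

namespace ODCSGD

noncomputable section

/-- The decision space `ℝ^d` with the Euclidean norm. -/
abbrev Vec (d : ℕ) : Type := EuclideanSpace ℝ (Fin d)

/-- The clipping operator `clip_c(y) = min {1, c / ‖y‖} y` (it maps `0` to `0`). -/
def clip {d : ℕ} (c : ℝ) (y : Vec d) : Vec d := min 1 (c / ‖y‖) • y

/-- The data of an online distributed optimization problem with `N` agents in `ℝ^d`, on the sample
space `Ω`. Rounds are numbered `t = 1, 2, …`; the values of the sequences at `t = 0` are not used.
* `f i t` is the local cost function `f_{i,t}`;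
* `ghat i t ω x` is the noisy gradient of `f_{i,t}` at the point `x`;
* `W t` is the weight matrix at time `t`;
* `edge t i j` means that agent `i` can receive a message from agent `j` at time `t`;
* `init i` is the initial state `x_{i,1}`;
* `xstar t` is the comparator `x_t^*`. -/
structure OnlineProblem (N d : ℕ) (Ω : Type*) where
  f : Fin N → ℕ → Vec d → ℝ
  ghat : Fin N → ℕ → Ω → Vec d → Vec d
  W : ℕ → Matrix (Fin N) (Fin N) ℝ
  edge : ℕ → Fin N → Fin N → Prop
  init : Fin N → Vec d
  xstar : ℕ → Vec d

/-- The clipping levels `2 B_g t^α`. -/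
def clipLevel (Bg α : ℝ) (t : ℕ) : ℝ := 2 * Bg * (t : ℝ) ^ α

/-- The step sizes `1 / (a t + b)^κ`. -/
def stepSize (a b κ : ℝ) (t : ℕ) : ℝ := 1 / (a * (t : ℝ) + b) ^ κ

namespace OnlineProblem

variable {N d : ℕ} {Ω : Type*}

/-- The iterates of the online distributed clipped stochastic gradient descent with clipping levels
`lam t` and step sizes `eta t`: `Q.state lam eta t ω i` is `x_{i,t}(ω)`, with `x_{i,1} = init i` and
`x_{i,t+1} = ∑ j, [W_t]_{ij} x_{j,t} - eta_t clip_{lam_t} (ghat_{i,t} (x_{i,t}))` for `t ≥ 1`.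
(The value at `t = 0` is a placeholder.) -/
def state (Q : OnlineProblem N d Ω) (lam eta : ℕ → ℝ) : ℕ → Ω → Fin N → Vec d
  | 0 => fun _ => Q.init
  | 1 => fun _ => Q.init
  | t + 2 => fun ω i =>
      (∑ j, Q.W (t + 1) i j • state Q lam eta (t + 1) ω j)
        - eta (t + 1) • clip (lam (t + 1))
            (Q.ghat i (t + 1) ω (state Q lam eta (t + 1) ω i))

/-- The average state at time `t`. -/
def avgState (Q : OnlineProblem N d Ω) (lam eta : ℕ → ℝ) (t : ℕ) (ω : Ω) : Vec d :=
  (1 / (N : ℝ)) • ∑ i, Q.state lam eta t ω i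

/-- The noisy gradient observed by agent `i` at time `t`, at its current state `x_{i,t}`. -/
def obs (Q : OnlineProblem N d Ω) (lam eta : ℕ → ℝ) (i : Fin N) (t : ℕ) (ω : Ω) : Vec d :=
  Q.ghat i t ω (Q.state lam eta t ω i)

/-- The exact gradient of `f_{i,t}` at the current state `x_{i,t}`. -/
def exactGrad (Q : OnlineProblem N d Ω) (lam eta : ℕ → ℝ) (i : Fin N) (t : ℕ) (ω : Ω) : Vec d :=
  gradient (Q.f i t) (Q.state lam eta t ω i)

/-- The `σ`-field `ℱ_t` generated by the noisy gradients observed by all agents at the times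
`1, …, t - 1`. -/
@[reducible] def past (Q : OnlineProblem N d Ω) (lam eta : ℕ → ℝ) (t : ℕ) : MeasurableSpace Ω :=
  ⨆ s ∈ Finset.Ico 1 t, ⨆ i : Fin N, MeasurableSpace.comap (Q.obs lam eta i s) inferInstance

/-- The global cost `f_t = ∑ i, f_{i,t}`. -/
def cost (Q : OnlineProblem N d Ω) (t : ℕ) (x : Vec d) : ℝ := ∑ i, Q.f i t x

/-- The dynamic regret `∑ i, ∑_{t ≤ T} (f_t(x_{i,t}) - f_t(x_t^*))`. -/
def regret (Q : OnlineProblem N d Ω) (lam eta : ℕ → ℝ) (T : ℕ) (ω : Ω) : ℝ :=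
  ∑ i, ∑ t ∈ Finset.Icc 1 T, (Q.cost t (Q.state lam eta t ω i) - Q.cost t (Q.xstar t))

/-- The path length `C_T = ∑_{t=2}^T ‖x_t^* - x_{t-1}^*‖`. -/
def pathLength (Q : OnlineProblem N d Ω) (T : ℕ) : ℝ :=
  ∑ t ∈ Finset.Icc 2 T, ‖Q.xstar t - Q.xstar (t - 1)‖

/-- The assumptions on the communication network: weights at least `w` on the edges and on the
diagonal and zero elsewhere, doubly stochastic weight matrices, and strong connectivity of the union
of any `B` consecutive graphs. -/
structure Network (Q : OnlineProblem N d Ω) (w : ℝ) (B : ℕ) : Prop where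
  weight_ge : ∀ t ≥ 1, ∀ i j, (Q.edge t i j ∨ j = i) → w ≤ Q.W t i j
  weight_zero : ∀ t ≥ 1, ∀ i j, ¬ (Q.edge t i j ∨ j = i) → Q.W t i j = 0
  row_sum : ∀ t ≥ 1, ∀ i, ∑ j, Q.W t i j = 1
  col_sum : ∀ t ≥ 1, ∀ j, ∑ i, Q.W t i j = 1
  connected : ∀ t ≥ 1, ∀ i j,
    Relation.ReflTransGen (fun i' j' => ∃ l < B, Q.edge (t + l) i' j') i j

/-- The assumptions on the local costs in the convex setting, in the rounds `1, …, T`: convexity and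
`L`-smoothness; `xstar t` is a minimizer of the global cost `f_t`. -/
structure ConvexCosts (Q : OnlineProblem N d Ω) (L : ℝ) (T : ℕ) : Prop where
  convex : ∀ i, ∀ t ∈ Finset.Icc 1 T, ConvexOn ℝ Set.univ (Q.f i t)
  differentiable : ∀ i, ∀ t ∈ Finset.Icc 1 T, Differentiable ℝ (Q.f i t)
  smooth : ∀ i, ∀ t ∈ Finset.Icc 1 T, ∀ x y,
    ‖gradient (Q.f i t) x - gradient (Q.f i t) y‖ ≤ L * ‖x - y‖
  minimizer : ∀ t ∈ Finset.Icc 1 T, ∀ x, Q.cost t (Q.xstar t) ≤ Q.cost t x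

/-- The assumptions on the noisy gradients in the rounds `1, …, T`: given the past, the noisy
gradient at the current state is unbiased and its error has a `p`-th moment at most `σ^p`. -/
structure HeavyTailedNoise [MeasurableSpace Ω] (Q : OnlineProblem N d Ω) (P : Measure Ω)
    (lam eta : ℕ → ℝ) (p σ : ℝ) (T : ℕ) : Prop where
  measurable : ∀ i, ∀ t ∈ Finset.Icc 1 T, Measurable (Q.obs lam eta i t)
  integrable : ∀ i, ∀ t ∈ Finset.Icc 1 T,
    Integrable (fun ω => ‖Q.obs lam eta i t ω - Q.exactGrad lam eta i t ω‖ ^ p) P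
  unbiased : ∀ i, ∀ t ∈ Finset.Icc 1 T,
    P[Q.obs lam eta i t | Q.past lam eta t] =ᵐ[P] Q.exactGrad lam eta i t
  moment : ∀ i, ∀ t ∈ Finset.Icc 1 T,
    ∀ᵐ ω ∂P, (P[fun ω' => ‖Q.obs lam eta i t ω' - Q.exactGrad lam eta i t ω'‖ ^ p
      | Q.past lam eta t]) ω ≤ σ ^ p

/-- Almost sure boundedness of the states and of the local gradients along the trajectory, in the
rounds `1, …, T`. -/
structure Bounded [MeasurableSpace Ω] (Q : OnlineProblem N d Ω) (P : Measure Ω)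
    (lam eta : ℕ → ℝ) (BX Bg : ℝ) (T : ℕ) : Prop where
  state_le : ∀ i, ∀ t ∈ Finset.Icc 1 T, ∀ᵐ ω ∂P, ‖Q.state lam eta t ω i‖ ≤ BX
  grad_state_le : ∀ i, ∀ t ∈ Finset.Icc 1 T, ∀ᵐ ω ∂P, ‖Q.exactGrad lam eta i t ω‖ ≤ Bg
  grad_avg_le : ∀ i, ∀ t ∈ Finset.Icc 1 T,
    ∀ᵐ ω ∂P, ‖gradient (Q.f i t) (Q.avgState lam eta t ω)‖ ≤ Bg

/-- All the assumptions of the convex setting up to the horizon `T`. -/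
structure ConvexSetting [MeasurableSpace Ω] (Q : OnlineProblem N d Ω) (P : Measure Ω)
    (lam eta : ℕ → ℝ) (p σ L BX Bg w : ℝ) (B T : ℕ) : Prop where
  network : Q.Network w B
  costs : Q.ConvexCosts L T
  noise : Q.HeavyTailedNoise P lam eta p σ T
  bounded : Q.Bounded P lam eta BX Bg T

end OnlineProblem

end

end ODCSGD

/-
Convexity bounds the regret by a sum of first-order terms along the average trajectory, a consensus
error, and a martingale sum of the clipped gradient noise. Mixing the matrices over `N * B` rounds
contracts the deviation from the average, so the consensus error is `O(√T)`; summation by parts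
bounds the first-order terms linearly in the size of the comparators. The clipping level dominates
the true gradients, so the bias and the second moment of the clipped noise are controlled by the
`p`-th moment, and the noise sum has a sub-exponential tail. With `T ^ α = T ^ (1 / (2 * p))` the
order of the clipping level and `κ = α + 1 / 2`, this yields, with probability `1 - δ`, a regret
`O((1 + C_T) * T ^ α * (√T + log (1 / δ)))`.

The product of `C_T` and `log (1 / δ)` is removed as follows. If `log (1 / δ) ≤ √T`, the bound is
already `O((1 + C_T) * T ^ κ)`. Otherwise take `δ = 1 / 2` instead: almost every trajectory stays in
the same ball as one of the good trajectories, and the regrets of two bounded trajectories differ by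
`O(T)` whatever the comparators are, while `T ≤ T ^ κ * log (1 / δ)`.
-/

namespace ODCSGD

section Gradient

variable {E : Type*} [NormedAddCommGroup E] [InnerProductSpace ℝ E] [CompleteSpace E]

lemma sub_le_inner_gradient {f : E → ℝ} (hf : ConvexOn ℝ Set.univ f) {x : E}
    (hd : DifferentiableAt ℝ f x) (y : E) : f x - f y ≤ inner ℝ (gradient f x) (x - y) := by
  let line : ℝ →ᵃ[ℝ] E := AffineMap.lineMap x y
  have hconvex : ConvexOn ℝ Set.univ (f ∘ line) := by simpa using hf.comp_affineMap line
  have hderiv : HasDerivAt (f ∘ line) (inner ℝ (gradient f x) (y - x)) 0 := by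
    have hline : HasDerivAt line (y - x) (0 : ℝ) := AffineMap.hasDerivAt_lineMap
    have hf' : HasFDerivAt f (InnerProductSpace.toDual ℝ E (gradient f x)) (line 0) := by
      simpa [line] using hd.hasGradientAt.hasFDerivAt
    simpa using hf'.comp_hasDerivAt (0 : ℝ) hline
  have hslope := hconvex.le_slope_of_hasDerivAt (Set.mem_univ 0) (Set.mem_univ 1) one_pos hderiv
  simp only [slope_def_field, Function.comp_apply, line, AffineMap.lineMap_apply_one,
    AffineMap.lineMap_apply_zero, sub_zero, div_one] at hslope
  rw [← neg_sub y x, inner_neg_right]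
  linarith

end Gradient

section Clip

variable {d : ℕ} {c p : ℝ} {y g : Vec d}

lemma norm_clip_le (hc : 0 ≤ c) (y : Vec d) : ‖clip c y‖ ≤ c := by
  rw [clip, norm_smul, Real.norm_of_nonneg (le_min zero_le_one (by positivity))]
  calc min 1 (c / ‖y‖) * ‖y‖ ≤ c / ‖y‖ * ‖y‖ := by gcongr; exact min_le_right _ _
    _ ≤ c := by rw [div_mul_comm]; exact mul_le_of_le_one_left hc (div_self_le_one _)

lemma clip_eq_self (h : ‖y‖ ≤ c) : clip c y = y := by
  rcases eq_or_ne y 0 with rfl | hy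
  · exact smul_zero _
  · rw [clip, min_eq_left ((one_le_div (norm_pos_iff.2 hy)).2 h), one_smul]

lemma norm_sub_clip_of_lt (hc : 0 ≤ c) (h : c < ‖y‖) : ‖y - clip c y‖ = ‖y‖ - c := by
  have hy : 0 < ‖y‖ := hc.trans_lt h
  have hle : c / ‖y‖ ≤ 1 := (div_le_one hy).2 h.le
  have heq : y - clip c y = (1 - c / ‖y‖) • y := by
    rw [clip, min_eq_right hle, sub_smul, one_smul]
  rw [heq, norm_smul, Real.norm_of_nonneg (sub_nonneg.2 hle)]
  field_simp

@[fun_prop]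
lemma measurable_clip (c : ℝ) : Measurable (clip c : Vec d → Vec d) := by
  unfold clip
  fun_prop

lemma norm_sub_clip_le_rpow (hc : 0 < c) (hp : 1 ≤ p) (hg : ‖g‖ ≤ c / 2) :
    ‖y - clip c y‖ ≤ (c / 2) ^ (1 - p) * ‖y - g‖ ^ p := by
  rcases le_or_gt ‖y‖ c with h | h
  · rw [clip_eq_self h, sub_self, norm_zero]; positivity
  · have htri : ‖y‖ - ‖g‖ ≤ ‖y - g‖ := norm_sub_norm_le y g
    have hz : c / 2 ≤ ‖y - g‖ := by linarith
    have hz0 : 0 < ‖y - g‖ := by linarith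
    calc ‖y - clip c y‖ = ‖y‖ - c := norm_sub_clip_of_lt hc.le h
      _ ≤ ‖y - g‖ := by linarith
      _ = ‖y - g‖ ^ (1 - p) * ‖y - g‖ ^ p := by simp [← Real.rpow_add hz0]
      _ ≤ (c / 2) ^ (1 - p) * ‖y - g‖ ^ p := by
        gcongr ?_ * _
        exact Real.rpow_le_rpow_of_nonpos (by linarith) hz (by linarith)

lemma norm_sub_clip_le (hc : 0 ≤ c) (hg : ‖g‖ ≤ c) : ‖g - clip c y‖ ≤ 2 * c := by
  linarith [norm_sub_le g (clip c y), norm_clip_le hc y]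

lemma norm_sub_clip_le_two_mul (hc : 0 ≤ c) (hg : ‖g‖ ≤ c) : ‖g - clip c y‖ ≤ 2 * ‖y - g‖ := by
  rcases le_or_gt ‖y‖ c with h | h
  · rw [clip_eq_self h, norm_sub_rev]
    linarith [norm_nonneg (y - g)]
  · have hsplit := norm_sub_le_norm_sub_add_norm_sub g y (clip c y)
    rw [norm_sub_rev g y, norm_sub_clip_of_lt hc h] at hsplit
    linarith [norm_sub_norm_le y g]

lemma norm_sub_clip_sq_le_rpow (hc : 0 ≤ c) (hp0 : 0 ≤ p) (hp2 : p ≤ 2) (hg : ‖g‖ ≤ c) :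
    ‖g - clip c y‖ ^ 2 ≤ 4 * c ^ (2 - p) * ‖y - g‖ ^ p := by
  have hn0 : 0 ≤ ‖g - clip c y‖ / 2 := by positivity
  have hn_le : ‖g - clip c y‖ / 2 ≤ c := by linarith [norm_sub_clip_le (y := y) hc hg]
  have hn_le' : ‖g - clip c y‖ / 2 ≤ ‖y - g‖ := by
    linarith [norm_sub_clip_le_two_mul (y := y) hc hg]
  calc ‖g - clip c y‖ ^ 2 = 4 * (‖g - clip c y‖ / 2) ^ ((2 - p) + p) := by
        rw [sub_add_cancel, Real.rpow_two]; ring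
    _ = 4 * ((‖g - clip c y‖ / 2) ^ (2 - p) * (‖g - clip c y‖ / 2) ^ p) := by
        rw [Real.rpow_add_of_nonneg hn0 (sub_nonneg.2 hp2) hp0]
    _ ≤ 4 * (c ^ (2 - p) * ‖y - g‖ ^ p) := by gcongr
    _ = 4 * c ^ (2 - p) * ‖y - g‖ ^ p := by ring

end Clip

section Sums

lemma exp_le_one_add_add_sq {x : ℝ} (hx : |x| ≤ 1) : Real.exp x ≤ 1 + x + x ^ 2 := by
  linarith [(abs_le.mp (Real.abs_exp_sub_one_sub_id_le hx)).2]

lemma one_div_sqrt_succ_le (n : ℕ) :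
    1 / √((n + 1 : ℕ) : ℝ) ≤ 2 * (√((n + 1 : ℕ) : ℝ) - √(n : ℝ)) := by
  have hpos : 0 < √((n + 1 : ℕ) : ℝ) := Real.sqrt_pos.2 (by positivity)
  have hsq : √(n : ℝ) ^ 2 = n := Real.sq_sqrt (by positivity)
  have hsq' : √((n + 1 : ℕ) : ℝ) ^ 2 = n + 1 := by
    rw [Real.sq_sqrt (by positivity)]; push_cast; ring
  rw [div_le_iff₀ hpos]
  nlinarith [sq_nonneg (√((n + 1 : ℕ) : ℝ) - √(n : ℝ))]

lemma sum_one_div_sqrt_le (T : ℕ) : ∑ t ∈ Finset.Icc 1 T, 1 / √(t : ℝ) ≤ 2 * √(T : ℝ) := by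
  induction T with
  | zero => simp
  | succ n ih =>
    rw [Finset.sum_Icc_succ_top (by lia)]
    linarith [one_div_sqrt_succ_le n]

lemma sum_Icc_mul_sub_le {q a b c : ℕ → ℝ} {M : ℝ} {T : ℕ} (hT : 1 ≤ T)
    (hq : ∀ t, 1 ≤ t → 0 ≤ q t) (hmono : ∀ t, 1 ≤ t → q t ≤ q (t + 1)) (ha : a 1 ≤ M)
    (hab : ∀ t, 1 ≤ t → t < T → a (t + 1) ≤ b t + c (t + 1))
    (hb : ∀ t, 1 ≤ t → t < T → b t ≤ M + ∑ s ∈ Finset.Icc 2 t, c s) :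
    ∑ t ∈ Finset.Icc 1 T, q t * (a t - b t) ≤
      q T * (M + ∑ t ∈ Finset.Icc 2 T, c t - b T) := by
  induction T, hT using Nat.le_induction with
  | base =>
    have := hq 1 le_rfl
    simp only [Finset.Icc_self, Finset.sum_singleton,
      Finset.Icc_eq_empty_of_lt one_lt_two, Finset.sum_empty, add_zero]
    gcongr
  | succ n hn ih =>
    have ih' := ih (fun t h h' ↦ hab t h (by lia)) (fun t h h' ↦ hb t h (by lia))
    have hgap : 0 ≤ M + ∑ t ∈ Finset.Icc 2 n, c t - b n := sub_nonneg.2 (hb n hn (by lia))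
    have hnext := hab n hn (by lia)
    rw [Finset.sum_Icc_succ_top (by lia), Finset.sum_Icc_succ_top (by lia)]
    calc _ ≤ q (n + 1) * (M + ∑ t ∈ Finset.Icc 2 n, c t - b n)
          + q (n + 1) * (b n + c (n + 1) - b (n + 1)) := by
          have := hq (n + 1) (by lia)
          gcongr ?_ + _ * (?_ - _)
          · exact ih'.trans (by gcongr; exact hmono n hn)
      _ = _ := by ring

variable {E : Type*} [NormedAddCommGroup E]

lemma norm_le_norm_one_add_sum (z : ℕ → E) {T : ℕ} (hT : 1 ≤ T) :
    ‖z T‖ ≤ ‖z 1‖ + ∑ t ∈ Finset.Icc 2 T, ‖z t - z (t - 1)‖ := by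
  induction T, hT using Nat.le_induction with
  | base => simp
  | succ n hn ih =>
    rw [Finset.sum_Icc_succ_top (by lia), Nat.add_sub_cancel]
    linarith [norm_sub_norm_le (z (n + 1)) (z n)]

variable [InnerProductSpace ℝ E]

lemma inner_smul_sub_sub {q : ℝ} (hq : q ≠ 0) (x x' z : E) :
    inner ℝ (q • (x - x')) (x - z) =
      q * ((‖x‖ ^ 2 / 2 - inner ℝ x z) - (‖x'‖ ^ 2 / 2 - inner ℝ x' z))
        + ‖q • (x - x')‖ ^ 2 / (2 * q) := by
  have hsq : ‖q • (x - x')‖ ^ 2 / (2 * q) = q * (‖x - x'‖ ^ 2 / 2) := by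
    rw [norm_smul, mul_pow, Real.norm_eq_abs, sq_abs]
    field_simp
  rw [hsq, real_inner_smul_left, norm_sub_sq_real, inner_sub_right, inner_sub_left,
    inner_sub_left, real_inner_self_eq_norm_sq, real_inner_comm x x']
  ring

lemma half_norm_sq_sub_inner_le {x : E} {A : ℝ} (hx : ‖x‖ ≤ A) (v : E) :
    ‖x‖ ^ 2 / 2 - inner ℝ x v ≤ A ^ 2 / 2 + A * ‖v‖ := by
  have hsq : ‖x‖ ^ 2 ≤ A ^ 2 := by gcongr
  have hinner : ‖x‖ * ‖v‖ ≤ A * ‖v‖ := by gcongr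
  linarith [neg_le_of_abs_le (abs_real_inner_le_norm x v)]

-- The usual telescoping of `‖x t - z t‖ ^ 2` would give a bound quadratic in the comparators. Here
-- the potentials `‖x‖ ^ 2 / 2 - ⟪x, z t⟫` are summed by parts, which keeps it linear.
lemma sum_inner_step_le {q : ℕ → ℝ} {x z g : ℕ → E} {A : ℝ} {T : ℕ} (hT : 1 ≤ T)
    (hq : ∀ t, 1 ≤ t → 0 < q t) (hmono : ∀ t, 1 ≤ t → q t ≤ q (t + 1))
    (hx : ∀ t ∈ Finset.Icc 1 (T + 1), ‖x t‖ ≤ A)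
    (hg : ∀ t ∈ Finset.Icc 1 T, g t = q t • (x t - x (t + 1))) :
    ∑ t ∈ Finset.Icc 1 T, inner ℝ (g t) (x t - z t) ≤
      q T * (A ^ 2 / 2 + 2 * A * (‖z 1‖ + ∑ t ∈ Finset.Icc 2 T, ‖z t - z (t - 1)‖))
        + ∑ t ∈ Finset.Icc 1 T, ‖g t‖ ^ 2 / (2 * q t) := by
  let pot (x z : E) : ℝ := ‖x‖ ^ 2 / 2 - inner ℝ x z
  have hx' (t) (h1 : 1 ≤ t) (ht : t ≤ T + 1) : ‖x t‖ ≤ A := hx t (Finset.mem_Icc.2 ⟨h1, ht⟩)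
  have hA : 0 ≤ A := (norm_nonneg _).trans (hx' 1 le_rfl (by lia))
  have hinner (t) (h1 : 1 ≤ t) (ht : t ≤ T + 1) (v : E) : inner ℝ (x t) v ≤ A * ‖v‖ :=
    (real_inner_le_norm _ _).trans (by gcongr; exact hx' t h1 ht)
  have hparts := sum_Icc_mul_sub_le (a := fun t ↦ pot (x t) (z t))
    (b := fun t ↦ pot (x (t + 1)) (z t)) (c := fun t ↦ A * ‖z t - z (t - 1)‖)
    (M := A ^ 2 / 2 + A * ‖z 1‖) hT (fun t ht ↦ (hq t ht).le) hmono
    (half_norm_sq_sub_inner_le (hx' 1 le_rfl (by lia)) _)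
    (fun t _ _ ↦ by
      have := hinner (t + 1) (by lia) (by lia) (z t - z (t + 1))
      rw [norm_sub_rev, inner_sub_right] at this
      simp only [pot, Nat.add_sub_cancel]
      linarith)
    (fun t h h' ↦ by
      rw [← Finset.mul_sum, add_assoc, ← mul_add]
      exact (half_norm_sq_sub_inner_le (hx' (t + 1) (by lia) (by lia)) _).trans
        (by gcongr; exact norm_le_norm_one_add_sum z h))
  have hlast : -pot (x (T + 1)) (z T) ≤
      A * (‖z 1‖ + ∑ t ∈ Finset.Icc 2 T, ‖z t - z (t - 1)‖) :=
    calc -pot (x (T + 1)) (z T) ≤ A * ‖z T‖ := by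
          simp only [pot]
          linarith [hinner (T + 1) (by lia) le_rfl (z T), sq_nonneg ‖x (T + 1)‖]
      _ ≤ _ := by gcongr; exact norm_le_norm_one_add_sum z hT
  have hterm (t) (ht : t ∈ Finset.Icc 1 T) : inner ℝ (g t) (x t - z t) =
      q t * (pot (x t) (z t) - pot (x (t + 1)) (z t)) + ‖g t‖ ^ 2 / (2 * q t) := by
    rw [hg t ht, inner_smul_sub_sub (hq t (Finset.mem_Icc.1 ht).1).ne']
  rw [Finset.sum_congr rfl hterm, Finset.sum_add_distrib]
  gcongr
  refine hparts.trans ?_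
  have := (hq T hT).le
  gcongr
  rw [← Finset.mul_sum]
  linarith

end Sums

section Averaging

open scoped Matrix.Module

variable {ι E : Type*} [Fintype ι] [NormedAddCommGroup E] [NormedSpace ℝ E]

/-- The deviations of a family of vectors from its average; the quantity that consensus shrinks. -/
noncomputable def dev (x : ι → E) (i : ι) : E := x i - (1 / (Fintype.card ι : ℝ)) • ∑ j, x j

lemma dev_add (x y : ι → E) : dev (x + y) = dev x + dev y := by
  ext i
  simp only [dev, Pi.add_apply, Finset.sum_add_distrib, smul_add]
  abel

lemma sum_dev [Nonempty ι] (x : ι → E) : ∑ i, dev x i = 0 := by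
  simp [dev, ← Nat.cast_smul_eq_nsmul ℝ, smul_smul]

lemma norm_average_le (x : ι → E) : ‖(1 / (Fintype.card ι : ℝ)) • ∑ i, x i‖ ≤ ‖x‖ := by
  rw [norm_smul, Real.norm_of_nonneg (by positivity)]
  calc 1 / (Fintype.card ι : ℝ) * ‖∑ i, x i‖ ≤ 1 / (Fintype.card ι : ℝ) * ∑ _i : ι, ‖x‖ := by
        gcongr
        exact norm_sum_le_of_le _ fun i _ ↦ norm_le_pi_norm x i
    _ ≤ ‖x‖ := by
        rw [Finset.sum_const, Finset.card_univ, nsmul_eq_mul, ← mul_assoc, one_div_mul_eq_div]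
        exact mul_le_of_le_one_left (norm_nonneg x) (div_self_le_one _)

lemma norm_dev_le (x : ι → E) : ‖dev x‖ ≤ 2 * ‖x‖ := by
  refine (pi_norm_le_iff_of_nonneg (by positivity)).2 fun i ↦ (norm_sub_le _ _).trans ?_
  linarith [norm_le_pi_norm x i, norm_average_le x]

variable [DecidableEq ι] {M : Matrix ι ι ℝ} {β : ℝ}

lemma dev_smul (hM : M ∈ doublyStochastic ℝ ι) (x : ι → E) : dev (M • x) = M • dev x := by
  have hsum : ∑ i, (M • x) i = ∑ i, x i := by
    simp only [Matrix.Module.smul_apply]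
    rw [Finset.sum_comm]
    simp only [← Finset.sum_smul, sum_col_of_mem_doublyStochastic hM, one_smul]
  ext i
  rw [dev, hsum]
  simp only [dev, Matrix.Module.smul_apply, smul_sub, Finset.sum_sub_distrib,
    ← Finset.sum_smul, sum_row_of_mem_doublyStochastic hM, one_smul]

lemma norm_smul_le_of_mem_rowStochastic (hM : M ∈ Matrix.rowStochastic ℝ ι) (x : ι → E) :
    ‖M • x‖ ≤ ‖x‖ := by
  refine (pi_norm_le_iff_of_nonneg (norm_nonneg x)).2 fun i ↦ ?_
  calc ‖∑ j, M i j • x j‖ ≤ ∑ j, M i j * ‖x‖ := norm_sum_le_of_le _ fun j _ ↦ by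
        have hij : 0 ≤ M i j := Matrix.nonneg_of_mem_rowStochastic hM
        rw [norm_smul, Real.norm_of_nonneg hij]
        gcongr
        exact norm_le_pi_norm x j
    _ = ‖x‖ := by rw [← Finset.sum_mul, Matrix.sum_row_of_mem_rowStochastic hM, one_mul]

lemma card_mul_le_one_of_le [Nonempty ι] (hM : M ∈ Matrix.rowStochastic ℝ ι)
    (hβ : ∀ i j, β ≤ M i j) : Fintype.card ι * β ≤ 1 := by
  obtain ⟨i⟩ := ‹Nonempty ι›
  calc Fintype.card ι * β = ∑ _j : ι, β := by simp
    _ ≤ ∑ j, M i j := Finset.sum_le_sum fun j _ ↦ hβ i j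
    _ = 1 := Matrix.sum_row_of_mem_rowStochastic hM i

-- On tuples with zero sum, `M` acts as the matrix `M i j - β`, whose entries are nonnegative.
lemma norm_smul_le_of_sum_eq_zero [Nonempty ι] (hM : M ∈ Matrix.rowStochastic ℝ ι)
    (hβ : ∀ i j, β ≤ M i j) {x : ι → E} (hx : ∑ i, x i = 0) :
    ‖M • x‖ ≤ (1 - Fintype.card ι * β) * ‖x‖ := by
  have hfactor := sub_nonneg.2 (card_mul_le_one_of_le hM hβ)
  refine (pi_norm_le_iff_of_nonneg (by positivity)).2 fun i ↦ ?_
  calc ‖∑ j, M i j • x j‖ = ‖∑ j, (M i j - β) • x j‖ := by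
        simp only [sub_smul, Finset.sum_sub_distrib, ← Finset.smul_sum, hx, smul_zero, sub_zero]
    _ ≤ ∑ j, (M i j - β) * ‖x‖ := norm_sum_le_of_le _ fun j _ ↦ by
        have hij : 0 ≤ M i j - β := sub_nonneg.2 (hβ i j)
        rw [norm_smul, Real.norm_of_nonneg hij]
        gcongr
        exact norm_le_pi_norm x j
    _ = (1 - Fintype.card ι * β) * ‖x‖ := by
        rw [← Finset.sum_mul, Finset.sum_sub_distrib, Matrix.sum_row_of_mem_rowStochastic hM]
        simp

/-- The product `W (t + k - 1) * ⋯ * W t` of the weight matrices of the `k` rounds that start at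
`t`. -/
def transitionMatrix (W : ℕ → Matrix ι ι ℝ) (t : ℕ) : ℕ → Matrix ι ι ℝ
  | 0 => 1
  | k + 1 => W (t + k) * transitionMatrix W t k

variable {W : ℕ → Matrix ι ι ℝ} {t : ℕ}

lemma transitionMatrix_mem {S : Submonoid (Matrix ι ι ℝ)} (hW : ∀ s, t ≤ s → W s ∈ S) (k : ℕ) :
    transitionMatrix W t k ∈ S := by
  induction k with
  | zero => exact S.one_mem
  | succ k ih => exact S.mul_mem (hW _ (by lia)) ih

lemma norm_sub_transitionMatrix_smul_le (hW : ∀ s, t ≤ s → W s ∈ Matrix.rowStochastic ℝ ι)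
    {x : ℕ → ι → E} {u : ℕ → ℝ} (hx : ∀ s, t ≤ s → ‖x (s + 1) - W s • x s‖ ≤ u s) (k : ℕ) :
    ‖x (t + k) - transitionMatrix W t k • x t‖ ≤ ∑ s ∈ Finset.range k, u (t + s) := by
  induction k with
  | zero => simp [transitionMatrix]
  | succ k ih =>
    have hsplit : x (t + (k + 1)) - transitionMatrix W t (k + 1) • x t =
        W (t + k) • (x (t + k) - transitionMatrix W t k • x t)
          + (x (t + k + 1) - W (t + k) • x (t + k)) := by
      rw [transitionMatrix, mul_smul, smul_sub, add_assoc]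
      abel
    rw [hsplit, Finset.sum_range_succ]
    exact (norm_add_le _ _).trans (add_le_add
      ((norm_smul_le_of_mem_rowStochastic (hW _ (by lia)) _).trans ih) (hx _ (by lia)))

lemma norm_dev_add_le [Nonempty ι] (hW : ∀ s, t ≤ s → W s ∈ doublyStochastic ℝ ι)
    {x : ℕ → ι → E} {u : ℕ → ℝ} (hx : ∀ s, t ≤ s → ‖x (s + 1) - W s • x s‖ ≤ u s)
    {k : ℕ} (hβ : ∀ i j, β ≤ transitionMatrix W t k i j) :
    ‖dev (x (t + k))‖ ≤ (1 - Fintype.card ι * β) * ‖dev (x t)‖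
      + 2 * ∑ s ∈ Finset.range k, u (t + s) := by
  have hrow (s) (hs : t ≤ s) : W s ∈ Matrix.rowStochastic ℝ ι :=
    (mem_doublyStochastic_iff_mem_rowStochastic_and_mem_colStochastic.1 (hW s hs)).1
  calc ‖dev (x (t + k))‖
      = ‖transitionMatrix W t k • dev (x t)
          + dev (x (t + k) - transitionMatrix W t k • x t)‖ := by
        rw [← dev_smul (transitionMatrix_mem hW k), ← dev_add, add_sub_cancel]
    _ ≤ ‖transitionMatrix W t k • dev (x t)‖
          + 2 * ‖x (t + k) - transitionMatrix W t k • x t‖ :=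
        (norm_add_le _ _).trans (by gcongr; exact norm_dev_le _)
    _ ≤ _ := by
        gcongr
        · exact norm_smul_le_of_sum_eq_zero (transitionMatrix_mem hrow k) hβ (sum_dev _)
        · exact norm_sub_transitionMatrix_smul_le hrow hx k

end Averaging

section Connectivity

lemma exists_rel_of_reflTransGen {α : Type*} {r : α → α → Prop} {S : Set α} {i j : α}
    (h : Relation.ReflTransGen r i j) (hi : i ∉ S) (hj : j ∈ S) :
    ∃ a ∉ S, ∃ b ∈ S, r a b := by
  induction h with
  | refl => exact absurd hj hi
  | @tail b c _ hbc ih =>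
    by_cases hb : b ∈ S
    · exact ih hb
    · exact ⟨b, hb, c, hj, hbc⟩

lemma eq_univ_of_ssubset_succ {α : Type*} [Fintype α] {S : ℕ → Finset α} (hS : (S 0).Nonempty)
    (hmono : Monotone S) (hlt : ∀ m, S m ≠ Finset.univ → S m ⊂ S (m + 1)) :
    S (Fintype.card α) = Finset.univ := by
  have hcard (m : ℕ) : S m = Finset.univ ∨ m + 1 ≤ (S m).card := by
    induction m with
    | zero => exact .inr hS.card_pos
    | succ m ih =>
      by_cases hu : S m = Finset.univ
      · exact .inl (Finset.univ_subset_iff.1 (hu ▸ hmono m.le_succ))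
      · exact .inr ((ih.resolve_left hu).trans_lt (Finset.card_lt_card (hlt m hu)))
  exact (hcard _).resolve_right (by have := (S (Fintype.card α)).card_le_univ; lia)

namespace OnlineProblem.Network

variable {N d : ℕ} {Ω : Type*} {Q : OnlineProblem N d Ω} {w : ℝ} {B t : ℕ}

lemma doublyStochastic (h : Q.Network w B) (hw : 0 ≤ w) (ht : 1 ≤ t) :
    Q.W t ∈ doublyStochastic ℝ (Fin N) := by
  refine mem_doublyStochastic_iff_sum.2 ⟨fun i j ↦ ?_, h.row_sum t ht, h.col_sum t ht⟩
  by_cases hij : Q.edge t i j ∨ j = i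
  · exact hw.trans (h.weight_ge t ht i j hij)
  · exact (h.weight_zero t ht i j hij).ge

lemma pow_le_transitionMatrix_succ (h : Q.Network w B) (hw : 0 ≤ w) (ht : 1 ≤ t) {k : ℕ}
    {i l j : Fin N} (hl : w ^ k ≤ transitionMatrix Q.W t k l j)
    (hil : Q.edge (t + k) i l ∨ l = i) :
    w ^ (k + 1) ≤ transitionMatrix Q.W t (k + 1) i j := by
  have hnonneg := (h.doublyStochastic hw (t := t + k) (by lia)).1
  have hnonneg' := (transitionMatrix_mem (t := t)
    (fun s hs ↦ h.doublyStochastic hw (ht.trans hs)) k).1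
  calc w ^ (k + 1) = w * w ^ k := pow_succ' w k
    _ ≤ Q.W (t + k) i l * transitionMatrix Q.W t k l j := by
        have := hnonneg i l
        gcongr
        exact h.weight_ge _ (by lia) _ _ hil
    _ ≤ ∑ l, Q.W (t + k) i l * transitionMatrix Q.W t k l j :=
        Finset.single_le_sum (f := fun l ↦ Q.W (t + k) i l * transitionMatrix Q.W t k l j)
          (fun l _ ↦ mul_nonneg (hnonneg i l) (hnonneg' l j)) (Finset.mem_univ l)

/-- The agents that the information held by agent `j` at time `t` has reached after `k` rounds, with
the weight that a chain of `k` edges guarantees. -/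
noncomputable def reached (Q : OnlineProblem N d Ω) (w : ℝ) (t : ℕ) (j : Fin N) (k : ℕ) :
    Finset (Fin N) :=
  {i | w ^ k ≤ transitionMatrix Q.W t k i j}

lemma mem_reached {i j : Fin N} {k : ℕ} :
    i ∈ reached Q w t j k ↔ w ^ k ≤ transitionMatrix Q.W t k i j := by
  simp [reached]

lemma reached_mono (h : Q.Network w B) (hw : 0 ≤ w) (ht : 1 ≤ t) (j : Fin N) :
    Monotone (reached Q w t j) :=
  monotone_nat_of_le_succ fun _ _ hi ↦
    mem_reached.2 (h.pow_le_transitionMatrix_succ hw ht (mem_reached.1 hi) (.inr rfl))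

lemma self_mem_reached (h : Q.Network w B) (hw : 0 ≤ w) (ht : 1 ≤ t) (j : Fin N) (k : ℕ) :
    j ∈ reached Q w t j k :=
  h.reached_mono hw ht j k.zero_le (mem_reached.2 (by simp [transitionMatrix]))

lemma reached_ssubset (h : Q.Network w B) (hw : 0 ≤ w) (ht : 1 ≤ t) {j : Fin N} {k : ℕ}
    (hne : reached Q w t j k ≠ Finset.univ) :
    reached Q w t j k ⊂ reached Q w t j (k + B) := by
  obtain ⟨i, hi⟩ : ∃ i, i ∉ reached Q w t j k := by
    simpa [Finset.eq_univ_iff_forall] using hne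
  obtain ⟨a, ha, b, hb, l, hl, hedge⟩ := exists_rel_of_reflTransGen
    (h.connected (t + k) (by lia) i j) (S := reached Q w t j k) hi (h.self_mem_reached hw ht j k)
  have hmono := h.reached_mono hw ht j
  have ha' : a ∈ reached Q w t j (k + l + 1) :=
    mem_reached.2 (h.pow_le_transitionMatrix_succ hw ht
      (mem_reached.1 (hmono (k.le_add_right l) hb)) (.inl (by rwa [← add_assoc])))
  exact ssubset_of_subset_not_subset (hmono (by lia))
    fun hsub ↦ ha (hsub (hmono (by lia) ha'))

lemma pow_le_transitionMatrix (h : Q.Network w B) (hw : 0 ≤ w) (ht : 1 ≤ t) (i j : Fin N) :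
    w ^ (N * B) ≤ transitionMatrix Q.W t (N * B) i j := by
  have huniv := eq_univ_of_ssubset_succ (S := fun m ↦ reached Q w t j (m * B))
    ⟨j, h.self_mem_reached hw ht j _⟩
    (fun m n hmn ↦ h.reached_mono hw ht j (Nat.mul_le_mul_right B hmn))
    (fun m hm ↦ by simpa only [Nat.succ_mul] using h.reached_ssubset hw ht hm)
  rw [Fintype.card_fin] at huniv
  exact mem_reached.1 (huniv ▸ Finset.mem_univ i)

end OnlineProblem.Network

end Connectivity

section ContractionSum

lemma sum_Icc_add_le {u : ℕ → ℝ} {n s T : ℕ} (hu : ∀ t, 1 ≤ t → 0 ≤ u t) (hn : n ≤ T - s) :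
    ∑ t ∈ Finset.Icc 1 n, u (t + s) ≤ ∑ t ∈ Finset.Icc 1 T, u t := by
  rw [← Finset.sum_image (f := u) (add_left_injective s).injOn]
  refine Finset.sum_le_sum_of_subset_of_nonneg ?_ fun t ht _ ↦ hu t (Finset.mem_Icc.1 ht).1
  rw [Finset.image_add_right_Icc]
  exact fun t ht ↦ by grind

lemma sum_Icc_le_card_mul_add_sum_shift {m : ℕ → ℝ} {M : ℝ} {T : ℕ} (hM : 0 ≤ M)
    (hmM : ∀ t ∈ Finset.Icc 1 T, m t ≤ M) (K : ℕ) :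
    ∑ t ∈ Finset.Icc 1 T, m t ≤ K * M + ∑ t ∈ Finset.Icc 1 (T - K), m (t + K) := by
  rw [← Finset.sum_image (f := m) (add_left_injective K).injOn, Finset.image_add_right_Icc,
    ← Finset.sum_filter_add_sum_filter_not (Finset.Icc 1 T) (· ≤ K)]
  refine add_le_add ?_ (Finset.sum_congr (by grind) fun _ _ ↦ rfl).le
  calc ∑ t ∈ Finset.Icc 1 T with t ≤ K, m t
      ≤ ((Finset.Icc 1 T).filter (· ≤ K)).card • M :=
        Finset.sum_le_card_nsmul _ _ _ fun t ht ↦ hmM t (Finset.mem_filter.1 ht).1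
    _ ≤ (Finset.Icc 1 K).card • M := by
        gcongr
        exact fun t ht ↦ by grind
    _ = K * M := by simp

lemma sum_le_of_contraction {m u : ℕ → ℝ} {ρ M : ℝ} {K T : ℕ} (hρ : 0 ≤ ρ)
    (hu : ∀ t, 1 ≤ t → 0 ≤ u t) (hm : ∀ t, 0 ≤ m t) (hM : 0 ≤ M)
    (hmM : ∀ t ∈ Finset.Icc 1 T, m t ≤ M)
    (h : ∀ t, 1 ≤ t → m (t + K) ≤ ρ * m t + 2 * ∑ s ∈ Finset.range K, u (t + s)) :
    (1 - ρ) * ∑ t ∈ Finset.Icc 1 T, m t ≤ K * M + 2 * K * ∑ t ∈ Finset.Icc 1 T, u t := by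
  have hshift : ∑ t ∈ Finset.Icc 1 (T - K), m (t + K) ≤
      ρ * ∑ t ∈ Finset.Icc 1 T, m t + 2 * K * ∑ t ∈ Finset.Icc 1 T, u t :=
    calc _ ≤ ∑ t ∈ Finset.Icc 1 (T - K), (ρ * m t + 2 * ∑ s ∈ Finset.range K, u (t + s)) :=
          Finset.sum_le_sum fun t ht ↦ h t (Finset.mem_Icc.1 ht).1
      _ = ρ * ∑ t ∈ Finset.Icc 1 (T - K), m t
          + 2 * ∑ s ∈ Finset.range K, ∑ t ∈ Finset.Icc 1 (T - K), u (t + s) := by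
          rw [Finset.sum_add_distrib, ← Finset.mul_sum, ← Finset.mul_sum, Finset.sum_comm]
      _ ≤ ρ * ∑ t ∈ Finset.Icc 1 T, m t
          + 2 * ∑ _s ∈ Finset.range K, ∑ t ∈ Finset.Icc 1 T, u t := by
          gcongr with s hs
          · exact fun t _ _ ↦ hm t
          · exact Nat.sub_le T K
          · exact sum_Icc_add_le hu (by have := Finset.mem_range.1 hs; lia)
      _ = _ := by rw [Finset.sum_const, Finset.card_range, nsmul_eq_mul]; ring
  linarith [sum_Icc_le_card_mul_add_sum_shift hM hmM K]

end ContractionSum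

section ConditionalExpectation

variable {Ω : Type*} {m m0 : MeasurableSpace Ω} {P : Measure Ω}
  {E : Type*} [NormedAddCommGroup E]

lemma integrable_inner_of_ae_bound [InnerProductSpace ℝ E] {h Z : Ω → E} {C : ℝ}
    (hh : AEStronglyMeasurable h P) (hC : ∀ᵐ ω ∂P, ‖h ω‖ ≤ C) (hZ : Integrable Z P) :
    Integrable (fun ω ↦ inner ℝ (h ω) (Z ω)) P := by
  refine (hZ.norm.const_mul C).mono' (hh.inner hZ.aestronglyMeasurable) ?_
  filter_upwards [hC] with ω hω
  exact (norm_inner_le_norm _ _).trans (by gcongr)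

lemma integral_inner_eq_zero_of_condExp_eq_zero [IsFiniteMeasure P] [InnerProductSpace ℝ E]
    [CompleteSpace E] (hm : m ≤ m0) {h Z : Ω → E} {C : ℝ} (hh : StronglyMeasurable[m] h)
    (hC : ∀ᵐ ω ∂P, ‖h ω‖ ≤ C) (hZ : Integrable Z P) (hZ0 : P[Z | m] =ᵐ[P] 0) :
    ∫ ω, inner ℝ (h ω) (Z ω) ∂P = 0 := by
  have hint := integrable_inner_of_ae_bound (hh.mono hm).aestronglyMeasurable hC hZ
  have hpull := condExp_bilin_of_stronglyMeasurable_left (innerSL ℝ) hh hint hZ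
  rw [← integral_condExp hm]
  refine integral_eq_zero_of_ae ?_
  filter_upwards [hpull, hZ0] with ω hω hω0
  exact hω.trans (by simp [hω0])

lemma integral_mul_le_of_condExp_le [IsFiniteMeasure P] (hm : m ≤ m0) {M ζ : Ω → ℝ} {C V : ℝ}
    (hM : StronglyMeasurable[m] M) (hM0 : ∀ ω, 0 ≤ M ω) (hC : ∀ᵐ ω ∂P, ‖M ω‖ ≤ C)
    (hζ : Integrable ζ P) (hV : ∀ᵐ ω ∂P, (P[ζ | m]) ω ≤ V) :
    ∫ ω, M ω * ζ ω ∂P ≤ V * ∫ ω, M ω ∂P := by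
  have hM' : AEStronglyMeasurable M P := (hM.mono hm).aestronglyMeasurable
  have hpull := condExp_mul_of_stronglyMeasurable_left hM (hζ.bdd_mul hM' hC) hζ
  calc ∫ ω, M ω * ζ ω ∂P = ∫ ω, (P[M * ζ | m]) ω ∂P := (integral_condExp hm).symm
    _ ≤ ∫ ω, V * M ω ∂P := by
        refine integral_mono_ae integrable_condExp ((Integrable.of_bound hM' C hC).const_mul V) ?_
        filter_upwards [hpull, hV] with ω hω hωV
        rw [hω, Pi.mul_apply, mul_comm]
        exact mul_le_mul_of_nonneg_right hωV (hM0 ω)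
    _ = V * ∫ ω, M ω ∂P := integral_const_mul _ _

lemma integrable_of_integrable_norm_rpow [IsFiniteMeasure P] {Z : Ω → E} {p : ℝ} (hp : 1 ≤ p)
    (hZ : AEStronglyMeasurable Z P) (h : Integrable (fun ω ↦ ‖Z ω‖ ^ p) P) : Integrable Z P := by
  have hp0 : 0 < p := one_pos.trans_le hp
  have hmem : MemLp Z (ENNReal.ofReal p) P := by
    rw [← integrable_norm_rpow_iff hZ (by simpa using hp0) ENNReal.ofReal_ne_top,
      ENNReal.toReal_ofReal hp0.le]
    exact h
  exact hmem.integrable (by simpa using hp)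

/-- `Y` is an unbiased noisy observation of the vector `G`, given the information `m`: `G` is known
given `m` and bounded by `c`, and the conditional `p`-th moment of the error is at most `V`. -/
structure HeavyTailedEstimator {Ω : Type*} (m : MeasurableSpace Ω) {m0 : MeasurableSpace Ω}
    (P : Measure Ω) {d : ℕ} (p V c : ℝ) (Y G : Ω → Vec d) : Prop where
  measurable : Measurable Y
  stronglyMeasurable : StronglyMeasurable[m] G
  norm_le : ∀ᵐ ω ∂P, ‖G ω‖ ≤ c
  integrable_rpow : Integrable (fun ω ↦ ‖Y ω - G ω‖ ^ p) P
  condExp_eq : P[Y | m] =ᵐ[P] G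
  condExp_rpow_le : ∀ᵐ ω ∂P, (P[fun ω' ↦ ‖Y ω' - G ω'‖ ^ p | m]) ω ≤ V

namespace HeavyTailedEstimator

variable [IsFiniteMeasure P] {d : ℕ} {p V c C : ℝ} {Y G : Ω → Vec d}

lemma integrable_sub (h : HeavyTailedEstimator m P p V c Y G) (hm : m ≤ m0) (hp : 1 ≤ p) :
    Integrable (G - Y) P := by
  have hsub : Integrable (Y - G) P := integrable_of_integrable_norm_rpow hp
    (h.measurable.aestronglyMeasurable.sub (h.stronglyMeasurable.mono hm).aestronglyMeasurable)
    h.integrable_rpow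
  rw [← neg_sub]
  exact hsub.neg

lemma condExp_sub_eq_zero (h : HeavyTailedEstimator m P p V c Y G) (hm : m ≤ m0) (hp : 1 ≤ p) :
    P[G - Y | m] =ᵐ[P] 0 := by
  have hG : Integrable G P :=
    .of_bound (h.stronglyMeasurable.mono hm).aestronglyMeasurable c h.norm_le
  have hY : Integrable Y P := by
    rw [← sub_sub_cancel G Y]
    exact hG.sub (h.integrable_sub hm hp)
  filter_upwards [condExp_sub hG hY m, h.condExp_eq] with ω hsub hω
  rw [condExp_of_stronglyMeasurable hm h.stronglyMeasurable hG] at hsub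
  simpa [hω] using hsub

end HeavyTailedEstimator

end ConditionalExpectation

section ClippedNoise

variable {ι : Type*} [Fintype ι] {d : ℕ} {c p D θ : ℝ}

/-- The total error of the clipped gradient estimates in the direction `v`. -/
noncomputable def clipNoise (c : ℝ) (G Y : ι → Vec d) (v : Vec d) : ℝ :=
  ∑ i, inner ℝ (G i - clip c (Y i)) v

/-- The rate, per unit of the `p`-th moment of one agent's gradient error, at which the exponential
moment of `θ` times the clipped noise of `n` agents grows, for directions of size at most `D`. -/
noncomputable def noiseRate (n p c D θ : ℝ) : ℝ :=
  θ * D * (c / 2) ^ (1 - p) + 4 * n * θ ^ 2 * D ^ 2 * c ^ (2 - p)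

lemma noiseRate_nonneg {n : ℝ} (hn : 0 ≤ n) (hc : 0 ≤ c) (hD : 0 ≤ D) (hθ : 0 ≤ θ) :
    0 ≤ noiseRate n p c D θ := by
  unfold noiseRate
  positivity

lemma noiseRate_le {n : ℝ} (hn : 0 < n) (hp : 0 ≤ p) (hc : 0 < c) (hD : 0 ≤ D) (hθ : 0 ≤ θ)
    (hθ1 : θ * (2 * n * c * D) ≤ 1) : noiseRate n p c D θ ≤ 2 / n * (c / 2) ^ (-p) := by
  have hq : θ * D * c ≤ 1 / (2 * n) := by
    rw [le_div_iff₀ (by positivity)]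
    linarith
  have hlin : θ * D * (c / 2) ^ (1 - p) ≤ 1 / n * (c / 2) ^ (-p) := by
    rw [sub_eq_add_neg, Real.rpow_add (by positivity), Real.rpow_one, ← mul_assoc]
    gcongr
    calc θ * D * (c / 2) = θ * D * c / 2 := by ring
      _ ≤ 1 / (2 * n) / 2 := by gcongr
      _ ≤ 1 / n := by
          rw [div_div]
          gcongr
          linarith
  have hsq : 4 * n * θ ^ 2 * D ^ 2 * c ^ (2 - p) ≤ 1 / n * (c / 2) ^ (-p) := by
    rw [sub_eq_add_neg, Real.rpow_add hc, Real.rpow_two, ← mul_assoc]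
    refine mul_le_mul ?_ ?_ (by positivity) (by positivity)
    · calc 4 * n * θ ^ 2 * D ^ 2 * c ^ 2 = 4 * n * (θ * D * c) ^ 2 := by ring
        _ ≤ 4 * n * (1 / (2 * n)) ^ 2 := by gcongr
        _ = 1 / n := by field_simp; norm_num
    · exact Real.rpow_le_rpow_of_nonpos (half_pos hc) (half_le_self hc.le) (neg_nonpos.2 hp)
  calc noiseRate n p c D θ ≤ 1 / n * (c / 2) ^ (-p) + 1 / n * (c / 2) ^ (-p) :=
        add_le_add hlin hsq
    _ = 2 / n * (c / 2) ^ (-p) := by ring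

section Pointwise

variable {G Y : ι → Vec d} {v : Vec d}

lemma abs_clipNoise_le (hc : 0 ≤ c) (hv : ‖v‖ ≤ D) (hG : ∀ i, ‖G i‖ ≤ c) :
    |clipNoise c G Y v| ≤ 2 * Fintype.card ι * c * D := by
  calc |clipNoise c G Y v| ≤ ∑ i, |inner ℝ (G i - clip c (Y i)) v| :=
        Finset.abs_sum_le_sum_abs _ _
    _ ≤ ∑ _i : ι, 2 * c * D := by
        gcongr with i
        exact (abs_real_inner_le_norm _ _).trans (by gcongr; exact norm_sub_clip_le hc (hG i))
    _ = 2 * Fintype.card ι * c * D := by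
        rw [Finset.sum_const, Finset.card_univ, nsmul_eq_mul]; ring

lemma clipNoise_le (hc : 0 < c) (hp : 1 ≤ p) (hv : ‖v‖ ≤ D) (hG : ∀ i, ‖G i‖ ≤ c / 2) :
    clipNoise c G Y v ≤
      ∑ i, inner ℝ v (G i - Y i) + D * (c / 2) ^ (1 - p) * ∑ i, ‖Y i - G i‖ ^ p := by
  rw [clipNoise, Finset.mul_sum, ← Finset.sum_add_distrib]
  gcongr with i
  calc inner ℝ (G i - clip c (Y i)) v
      = inner ℝ v (G i - Y i) + inner ℝ v (Y i - clip c (Y i)) := by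
        rw [← inner_add_right, sub_add_sub_cancel, real_inner_comm]
    _ ≤ inner ℝ v (G i - Y i) + D * ((c / 2) ^ (1 - p) * ‖Y i - G i‖ ^ p) := by
        have hclip := norm_sub_clip_le_rpow (y := Y i) hc hp (hG i)
        have hD : 0 ≤ D := (norm_nonneg v).trans hv
        gcongr
        exact (real_inner_le_norm _ _).trans (by gcongr)
    _ = _ := by ring

lemma clipNoise_sq_le (hc : 0 ≤ c) (hp0 : 0 ≤ p) (hp2 : p ≤ 2) (hv : ‖v‖ ≤ D)
    (hG : ∀ i, ‖G i‖ ≤ c) :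
    clipNoise c G Y v ^ 2 ≤
      4 * Fintype.card ι * D ^ 2 * c ^ (2 - p) * ∑ i, ‖Y i - G i‖ ^ p := by
  have hterm (i) :
      inner ℝ (G i - clip c (Y i)) v ^ 2 ≤ 4 * D ^ 2 * c ^ (2 - p) * ‖Y i - G i‖ ^ p :=
    calc inner ℝ (G i - clip c (Y i)) v ^ 2 ≤ (‖G i - clip c (Y i)‖ * ‖v‖) ^ 2 :=
          sq_le_sq.2 ((abs_real_inner_le_norm _ _).trans (le_abs_self _))
      _ = ‖G i - clip c (Y i)‖ ^ 2 * ‖v‖ ^ 2 := mul_pow _ _ 2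
      _ ≤ 4 * c ^ (2 - p) * ‖Y i - G i‖ ^ p * D ^ 2 := by
          gcongr
          exact norm_sub_clip_sq_le_rpow hc hp0 hp2 (hG i)
      _ = 4 * D ^ 2 * c ^ (2 - p) * ‖Y i - G i‖ ^ p := by ring
  calc clipNoise c G Y v ^ 2
      ≤ Fintype.card ι * ∑ i, inner ℝ (G i - clip c (Y i)) v ^ 2 := sq_sum_le_card_mul_sum_sq
    _ ≤ Fintype.card ι * ∑ i, 4 * D ^ 2 * c ^ (2 - p) * ‖Y i - G i‖ ^ p := by
        gcongr with i
        exact hterm i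
    _ = _ := by rw [← Finset.mul_sum]; ring

lemma exp_mul_clipNoise_le (hc : 0 < c) (hp : 1 ≤ p) (hp2 : p ≤ 2) (hθ : 0 ≤ θ)
    (hθ1 : θ * (2 * Fintype.card ι * c * D) ≤ 1) (hv : ‖v‖ ≤ D) (hG : ∀ i, ‖G i‖ ≤ c / 2) :
    Real.exp (θ * clipNoise c G Y v) ≤
      1 + θ * ∑ i, inner ℝ v (G i - Y i)
        + noiseRate (Fintype.card ι) p c D θ * ∑ i, ‖Y i - G i‖ ^ p := by
  have hG' (i) : ‖G i‖ ≤ c := (hG i).trans (by linarith)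
  have habs : |θ * clipNoise c G Y v| ≤ 1 := by
    rw [abs_mul, abs_of_nonneg hθ]
    exact (mul_le_mul_of_nonneg_left (abs_clipNoise_le hc.le hv hG') hθ).trans hθ1
  calc Real.exp (θ * clipNoise c G Y v)
      ≤ 1 + θ * clipNoise c G Y v + θ ^ 2 * clipNoise c G Y v ^ 2 := by
        rw [← mul_pow]; exact exp_le_one_add_add_sq habs
    _ ≤ 1 + θ * (∑ i, inner ℝ v (G i - Y i) + D * (c / 2) ^ (1 - p) * ∑ i, ‖Y i - G i‖ ^ p)
        + θ ^ 2 * (4 * Fintype.card ι * D ^ 2 * c ^ (2 - p) * ∑ i, ‖Y i - G i‖ ^ p) := by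
        gcongr
        · exact clipNoise_le hc hp hv hG
        · exact clipNoise_sq_le hc.le (by linarith) hp2 hv hG'
    _ = _ := by rw [noiseRate]; ring

end Pointwise

variable {Ω : Type*} {m m0 : MeasurableSpace Ω} {P : Measure Ω} [IsFiniteMeasure P] {V C : ℝ}
  {M : Ω → ℝ} {v : Ω → Vec d} {G Y : ι → Ω → Vec d}

lemma integral_smul_inner_eq_zero (hm : m ≤ m0) (hp : 1 ≤ p)
    (hMm : StronglyMeasurable[m] M) (hM : ∀ᵐ ω ∂P, ‖M ω‖ ≤ C)
    (hvm : StronglyMeasurable[m] v) (hv : ∀ᵐ ω ∂P, ‖v ω‖ ≤ D)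
    (hYG : ∀ i, HeavyTailedEstimator m P p V c (Y i) (G i)) :
    Integrable (fun ω ↦ ∑ i, inner ℝ (M ω • v ω) (G i ω - Y i ω)) P ∧
      ∫ ω, ∑ i, inner ℝ (M ω • v ω) (G i ω - Y i ω) ∂P = 0 := by
  have hbound : ∀ᵐ ω ∂P, ‖M ω • v ω‖ ≤ C * D := by
    filter_upwards [hM, hv] with ω hω hω'
    rw [norm_smul]
    exact mul_le_mul hω hω' (norm_nonneg _) ((norm_nonneg _).trans hω)
  have hint (i) : Integrable (fun ω ↦ inner ℝ (M ω • v ω) (G i ω - Y i ω)) P :=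
    integrable_inner_of_ae_bound ((hMm.smul hvm).mono hm).aestronglyMeasurable hbound
      ((hYG i).integrable_sub hm hp)
  refine ⟨integrable_finsetSum _ fun i _ ↦ hint i, ?_⟩
  rw [integral_finsetSum _ fun i _ ↦ hint i]
  exact Finset.sum_eq_zero fun i _ ↦ integral_inner_eq_zero_of_condExp_eq_zero hm
    (hMm.smul hvm) hbound ((hYG i).integrable_sub hm hp) ((hYG i).condExp_sub_eq_zero hm hp)

lemma integral_mul_sum_rpow_le (hm : m ≤ m0)
    (hMm : StronglyMeasurable[m] M) (hM0 : ∀ ω, 0 ≤ M ω) (hM : ∀ᵐ ω ∂P, ‖M ω‖ ≤ C)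
    (hYG : ∀ i, HeavyTailedEstimator m P p V c (Y i) (G i)) :
    Integrable (fun ω ↦ M ω * ∑ i, ‖Y i ω - G i ω‖ ^ p) P ∧
      ∫ ω, M ω * ∑ i, ‖Y i ω - G i ω‖ ^ p ∂P ≤ Fintype.card ι * V * ∫ ω, M ω ∂P := by
  have hint (i) : Integrable (fun ω ↦ M ω * ‖Y i ω - G i ω‖ ^ p) P :=
    (hYG i).integrable_rpow.bdd_mul (hMm.mono hm).aestronglyMeasurable hM
  simp only [Finset.mul_sum]
  refine ⟨integrable_finsetSum _ fun i _ ↦ hint i, ?_⟩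
  rw [integral_finsetSum _ fun i _ ↦ hint i]
  calc ∑ i, ∫ ω, M ω * ‖Y i ω - G i ω‖ ^ p ∂P ≤ ∑ _i : ι, V * ∫ ω, M ω ∂P :=
        Finset.sum_le_sum fun i _ ↦ integral_mul_le_of_condExp_le hm hMm hM0 hM
          (hYG i).integrable_rpow (hYG i).condExp_rpow_le
    _ = _ := by rw [Finset.sum_const, Finset.card_univ, nsmul_eq_mul, mul_assoc]

lemma integral_mul_exp_clipNoise_le (hm : m ≤ m0) (hc : 0 < c) (hp : 1 ≤ p) (hp2 : p ≤ 2)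
    (hD : 0 ≤ D) (hθ : 0 ≤ θ) (hθ1 : θ * (2 * Fintype.card ι * c * D) ≤ 1)
    (hMm : StronglyMeasurable[m] M) (hM0 : ∀ ω, 0 ≤ M ω) (hM : ∀ᵐ ω ∂P, ‖M ω‖ ≤ C)
    (hvm : StronglyMeasurable[m] v) (hv : ∀ᵐ ω ∂P, ‖v ω‖ ≤ D)
    (hYG : ∀ i, HeavyTailedEstimator m P p V (c / 2) (Y i) (G i)) :
    ∫ ω, M ω * Real.exp (θ * clipNoise c (G · ω) (Y · ω) (v ω)) ∂P ≤
      (1 + noiseRate (Fintype.card ι) p c D θ * (Fintype.card ι * V)) * ∫ ω, M ω ∂P := by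
  set r := noiseRate (Fintype.card ι) p c D θ
  have hr : 0 ≤ r := noiseRate_nonneg (by positivity) hc.le hD hθ
  have hMi : Integrable M P := .of_bound (hMm.mono hm).aestronglyMeasurable C hM
  obtain ⟨hlin_int, hlin⟩ := integral_smul_inner_eq_zero hm hp hMm hM hvm hv hYG
  obtain ⟨hpow_int, hpow⟩ := integral_mul_sum_rpow_le hm hMm hM0 hM hYG
  calc ∫ ω, M ω * Real.exp (θ * clipNoise c (G · ω) (Y · ω) (v ω)) ∂P
      ≤ ∫ ω, (M ω + θ * ∑ i, inner ℝ (M ω • v ω) (G i ω - Y i ω)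
          + r * (M ω * ∑ i, ‖Y i ω - G i ω‖ ^ p)) ∂P := by
        refine integral_mono_of_nonneg
          (ae_of_all _ fun ω ↦ mul_nonneg (hM0 ω) (Real.exp_nonneg _))
          ((hMi.add (hlin_int.const_mul θ)).add (hpow_int.const_mul r)) ?_
        filter_upwards [hv, ae_all_iff.2 fun i ↦ (hYG i).norm_le] with ω hω hωG
        refine (mul_le_mul_of_nonneg_left
          (exp_mul_clipNoise_le hc hp hp2 hθ hθ1 hω hωG) (hM0 ω)).trans_eq ?_
        simp only [real_inner_smul_left, ← Finset.mul_sum]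
        ring
    _ = ∫ ω, M ω ∂P + r * ∫ ω, M ω * ∑ i, ‖Y i ω - G i ω‖ ^ p ∂P := by
        rw [integral_add (by exact hMi.add (hlin_int.const_mul θ)) (hpow_int.const_mul r),
          integral_add hMi (hlin_int.const_mul θ), integral_const_mul, integral_const_mul, hlin,
          mul_zero, add_zero]
    _ ≤ ∫ ω, M ω ∂P + r * (Fintype.card ι * V * ∫ ω, M ω ∂P) := by gcongr
    _ = _ := by ring

end ClippedNoise

section ExponentialMoment

variable {Ω : Type*} {m0 : MeasurableSpace Ω} {P : Measure Ω} {ℱ : ℕ → MeasurableSpace Ω}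
  {X : ℕ → Ω → ℝ} {T : ℕ}

lemma measurable_sum_Icc_of_adapted (hℱ : Monotone ℱ)
    (hX : ∀ t ∈ Finset.Icc 1 T, Measurable[ℱ (t + 1)] (X t)) :
    Measurable[ℱ (T + 1)] (fun ω ↦ ∑ t ∈ Finset.Icc 1 T, X t ω) :=
  Finset.measurable_fun_sum _ fun t ht ↦
    (hX t ht).mono (hℱ (Nat.succ_le_succ (Finset.mem_Icc.1 ht).2)) le_rfl

lemma ae_norm_exp_sum_le {K : ℕ → ℝ} (hK : ∀ t ∈ Finset.Icc 1 T, ∀ᵐ ω ∂P, X t ω ≤ K t) :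
    ∀ᵐ ω ∂P, ‖Real.exp (∑ t ∈ Finset.Icc 1 T, X t ω)‖
      ≤ Real.exp (∑ t ∈ Finset.Icc 1 T, K t) := by
  filter_upwards [(ae_ball_iff (Finset.Icc 1 T).countable_toSet).2 hK] with ω hω
  rw [Real.norm_of_nonneg (Real.exp_nonneg _), Real.exp_le_exp]
  exact Finset.sum_le_sum hω

lemma integral_exp_sum_le [IsProbabilityMeasure P] {K r : ℕ → ℝ} (hℱ : Monotone ℱ)
    (hX : ∀ t ∈ Finset.Icc 1 T, Measurable[ℱ (t + 1)] (X t))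
    (hK : ∀ t ∈ Finset.Icc 1 T, ∀ᵐ ω ∂P, X t ω ≤ K t)
    (hstep : ∀ t ∈ Finset.Icc 1 T, ∀ (M : Ω → ℝ) (C : ℝ), StronglyMeasurable[ℱ t] M →
      (∀ ω, 0 ≤ M ω) → (∀ᵐ ω ∂P, ‖M ω‖ ≤ C) →
        ∫ ω, M ω * Real.exp (X t ω) ∂P ≤ (1 + r t) * ∫ ω, M ω ∂P) :
    ∫ ω, Real.exp (∑ t ∈ Finset.Icc 1 T, X t ω) ∂P ≤ Real.exp (∑ t ∈ Finset.Icc 1 T, r t) := by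
  induction T with
  | zero => simp
  | succ n ih =>
    have hsub : Finset.Icc 1 n ⊆ Finset.Icc 1 (n + 1) := Finset.Icc_subset_Icc_right n.le_succ
    have hmem : n + 1 ∈ Finset.Icc 1 (n + 1) := by simp
    have hprev := ih (fun t ht ↦ hX t (hsub ht)) (fun t ht ↦ hK t (hsub ht))
      (fun t ht ↦ hstep t (hsub ht))
    have hmeas := measurable_sum_Icc_of_adapted hℱ fun t ht ↦ hX t (hsub ht)
    simp only [Finset.sum_Icc_succ_top (Nat.le_add_left 1 n), Real.exp_add]
    calc ∫ ω, Real.exp (∑ t ∈ Finset.Icc 1 n, X t ω) * Real.exp (X (n + 1) ω) ∂P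
        ≤ (1 + r (n + 1)) * ∫ ω, Real.exp (∑ t ∈ Finset.Icc 1 n, X t ω) ∂P :=
          hstep _ hmem _ _ hmeas.exp.stronglyMeasurable (fun _ ↦ Real.exp_nonneg _)
            (ae_norm_exp_sum_le fun t ht ↦ hK t (hsub ht))
      _ ≤ Real.exp (r (n + 1)) * Real.exp (∑ t ∈ Finset.Icc 1 n, r t) := by
          gcongr
          rw [add_comm]
          exact Real.add_one_le_exp _
      _ = _ := mul_comm _ _

lemma measure_ge_le_of_mgf_le [IsFiniteMeasure P] {S : Ω → ℝ} {θ A δ : ℝ} (hθ : 0 < θ)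
    (hδ : 0 < δ) (hS : Integrable (fun ω ↦ Real.exp (θ * S ω)) P)
    (hA : ProbabilityTheory.mgf S P θ ≤ Real.exp A) :
    P {ω | (A + Real.log (1 / δ)) / θ ≤ S ω} ≤ ENNReal.ofReal δ := by
  rw [ENNReal.le_ofReal_iff_toReal_le (measure_ne_top _ _) hδ.le]
  calc P.real {ω | (A + Real.log (1 / δ)) / θ ≤ S ω}
      ≤ Real.exp (-θ * ((A + Real.log (1 / δ)) / θ)) * ProbabilityTheory.mgf S P θ :=
        ProbabilityTheory.measure_ge_le_exp_mul_mgf _ hθ.le hS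
    _ ≤ Real.exp (-θ * ((A + Real.log (1 / δ)) / θ)) * Real.exp A := by gcongr
    _ = δ := by
        have hexp : -θ * ((A + Real.log (1 / δ)) / θ) + A = Real.log δ := by
          rw [one_div, Real.log_inv]
          field_simp
          ring
        rw [← Real.exp_add, hexp, Real.exp_log hδ]

end ExponentialMoment

@[fun_prop]
lemma measurable_clipNoise {ι Ω : Type*} [Fintype ι] {m : MeasurableSpace Ω} {d : ℕ} {c : ℝ}
    {G Y : ι → Ω → Vec d} {v : Ω → Vec d} (hG : ∀ i, Measurable (G i))
    (hY : ∀ i, Measurable (Y i)) (hv : Measurable v) :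
    Measurable (fun ω ↦ clipNoise c (G · ω) (Y · ω) (v ω)) := by
  unfold clipNoise
  fun_prop

namespace OnlineProblem

/-- The part of `ConvexCosts` that does not involve the comparators: convexity and `L`-smoothness
of the local costs in the rounds `1, …, T`. -/
structure SmoothConvexCosts {N d : ℕ} {Ω : Type*} (Q : OnlineProblem N d Ω) (L : ℝ) (T : ℕ) :
    Prop where
  convex : ∀ i, ∀ t ∈ Finset.Icc 1 T, ConvexOn ℝ Set.univ (Q.f i t)
  differentiable : ∀ i, ∀ t ∈ Finset.Icc 1 T, Differentiable ℝ (Q.f i t)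
  smooth : ∀ i, ∀ t ∈ Finset.Icc 1 T, ∀ x y,
    ‖gradient (Q.f i t) x - gradient (Q.f i t) y‖ ≤ L * ‖x - y‖

section Measurability

variable {N d : ℕ} {Ω : Type*} (Q : OnlineProblem N d Ω) (lam eta : ℕ → ℝ)

lemma past_mono : Monotone (Q.past lam eta) := fun _ _ hst ↦
  biSup_mono fun _ hr ↦ Finset.Ico_subset_Ico_right hst hr

lemma measurable_obs_past (i : Fin N) {s t : ℕ} (hs : 1 ≤ s) (hst : s < t) :
    Measurable[Q.past lam eta t] (Q.obs lam eta i s) :=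
  (comap_measurable _).mono
    ((le_iSup (fun j ↦ MeasurableSpace.comap (Q.obs lam eta j s) inferInstance) i).trans
      (le_iSup₂_of_le s (Finset.mem_Ico.2 ⟨hs, hst⟩) le_rfl)) le_rfl

lemma state_succ {t : ℕ} (ht : 1 ≤ t) (ω : Ω) (i : Fin N) :
    Q.state lam eta (t + 1) ω i = (∑ j, Q.W t i j • Q.state lam eta t ω j)
      - eta t • clip (lam t) (Q.obs lam eta i t ω) := by
  obtain ⟨s, rfl⟩ := Nat.exists_eq_add_of_le' ht
  rfl

lemma measurable_state_past {t : ℕ} (ht : 1 ≤ t) (i : Fin N) :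
    Measurable[Q.past lam eta t] (fun ω ↦ Q.state lam eta t ω i) := by
  induction t, ht using Nat.le_induction generalizing i with
  | base => exact @measurable_const _ _ _ (Q.past lam eta 1) _
  | succ t ht ih =>
    have hstate (j) : Measurable[Q.past lam eta (t + 1)] (fun ω ↦ Q.state lam eta t ω j) :=
      (ih j).mono (Q.past_mono lam eta t.le_succ) le_rfl
    have hobs := Q.measurable_obs_past lam eta i ht t.lt_succ_self
    simp only [Q.state_succ lam eta ht]
    let := Q.past lam eta (t + 1)
    fun_prop

lemma measurable_avgState_past {t : ℕ} (ht : 1 ≤ t) :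
    Measurable[Q.past lam eta t] (Q.avgState lam eta t) := by
  have hstate (i) := Q.measurable_state_past lam eta ht i
  unfold avgState
  let := Q.past lam eta t
  fun_prop

variable {Q}

lemma SmoothConvexCosts.measurable_exactGrad_past {L : ℝ} {T t : ℕ} (hQ : Q.SmoothConvexCosts L T)
    (hL : 0 ≤ L) (ht : t ∈ Finset.Icc 1 T) (i : Fin N) :
    Measurable[Q.past lam eta t] (Q.exactGrad lam eta i t) := by
  have hlip : LipschitzWith L.toNNReal (gradient (Q.f i t)) :=
    LipschitzWith.of_dist_le_mul fun x y ↦ by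
      rw [dist_eq_norm, dist_eq_norm, Real.coe_toNNReal _ hL]
      exact hQ.smooth i t ht x y
  exact hlip.continuous.measurable.comp
    (Q.measurable_state_past lam eta (Finset.mem_Icc.1 ht).1 i)

lemma HeavyTailedNoise.past_le [m0 : MeasurableSpace Ω] {P : Measure Ω} {p σ : ℝ} {T t : ℕ}
    {lam eta : ℕ → ℝ} (h : Q.HeavyTailedNoise P lam eta p σ T) (ht : t ≤ T + 1) :
    Q.past lam eta t ≤ m0 :=
  iSup₂_le fun s hs ↦ iSup_le fun i ↦
    (h.measurable i s (by rw [Finset.mem_Ico] at hs; rw [Finset.mem_Icc]; lia)).comap_le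

end Measurability

section Noise

variable {N d : ℕ} {Ω : Type*}

/-- The total error of the clipped gradients at time `t`, in the direction from the comparator to
the average state. -/
noncomputable def noise (Q : OnlineProblem N d Ω) (lam eta : ℕ → ℝ) (t : ℕ) (ω : Ω) : ℝ :=
  clipNoise (lam t) (Q.exactGrad lam eta · t ω) (Q.obs lam eta · t ω)
    (Q.avgState lam eta t ω - Q.xstar t)

/-- The clipped noise accumulated in the rounds `1, …, T`. -/
noncomputable def noiseSum (Q : OnlineProblem N d Ω) (lam eta : ℕ → ℝ) (T : ℕ) (ω : Ω) : ℝ :=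
  ∑ t ∈ Finset.Icc 1 T, Q.noise lam eta t ω

variable {Q : OnlineProblem N d Ω} {lam eta : ℕ → ℝ} {L p σ D θ δ : ℝ} {T t : ℕ}

lemma measurable_noise_past (hcosts : Q.SmoothConvexCosts L T) (hL : 0 ≤ L)
    (ht : t ∈ Finset.Icc 1 T) : Measurable[Q.past lam eta (t + 1)] (Q.noise lam eta t) := by
  have ht1 := (Finset.mem_Icc.1 ht).1
  have hle := Q.past_mono lam eta t.le_succ
  have hG (i) := (hcosts.measurable_exactGrad_past lam eta hL ht i).mono hle le_rfl
  have hY (i) := Q.measurable_obs_past lam eta i ht1 t.lt_succ_self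
  have hv := (Q.measurable_avgState_past lam eta ht1).mono hle le_rfl
  let := Q.past lam eta (t + 1)
  exact measurable_clipNoise hG hY (hv.sub_const _)

variable [MeasurableSpace Ω] {P : Measure Ω}

lemma HeavyTailedNoise.heavyTailedEstimator (hnoise : Q.HeavyTailedNoise P lam eta p σ T)
    (hcosts : Q.SmoothConvexCosts L T) (hL : 0 ≤ L) (ht : t ∈ Finset.Icc 1 T) {c : ℝ} {i : Fin N}
    (hG : ∀ᵐ ω ∂P, ‖Q.exactGrad lam eta i t ω‖ ≤ c) :
    HeavyTailedEstimator (Q.past lam eta t) P p (σ ^ p) c (Q.obs lam eta i t)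
      (Q.exactGrad lam eta i t) where
  measurable := hnoise.measurable i t ht
  stronglyMeasurable := (hcosts.measurable_exactGrad_past lam eta hL ht i).stronglyMeasurable
  norm_le := hG
  integrable_rpow := hnoise.integrable i t ht
  condExp_eq := hnoise.unbiased i t ht
  condExp_rpow_le := hnoise.moment i t ht

lemma mgf_noiseSum_le [IsProbabilityMeasure P] (hnoise : Q.HeavyTailedNoise P lam eta p σ T)
    (hcosts : Q.SmoothConvexCosts L T) (hL : 0 ≤ L) (hp : 1 ≤ p) (hp2 : p ≤ 2) (hD : 0 ≤ D)
    (hθ : 0 ≤ θ) (hlam : ∀ t ∈ Finset.Icc 1 T, 0 < lam t)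
    (hθ1 : ∀ t ∈ Finset.Icc 1 T, θ * (2 * N * lam t * D) ≤ 1)
    (hG : ∀ i, ∀ t ∈ Finset.Icc 1 T, ∀ᵐ ω ∂P, ‖Q.exactGrad lam eta i t ω‖ ≤ lam t / 2)
    (hv : ∀ t ∈ Finset.Icc 1 T, ∀ᵐ ω ∂P, ‖Q.avgState lam eta t ω - Q.xstar t‖ ≤ D) :
    Integrable (fun ω ↦ Real.exp (θ * Q.noiseSum lam eta T ω)) P ∧
      ProbabilityTheory.mgf (Q.noiseSum lam eta T) P θ ≤
        Real.exp (∑ t ∈ Finset.Icc 1 T, noiseRate N p (lam t) D θ * (N * σ ^ p)) := by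
  have hpast (t) (ht : t ∈ Finset.Icc 1 T) := hnoise.past_le (t := t + 1) (by simp_all)
  have hmeas (t) (ht : t ∈ Finset.Icc 1 T) :
      Measurable[Q.past lam eta (t + 1)] (fun ω ↦ θ * Q.noise lam eta t ω) :=
    (measurable_noise_past hcosts hL ht).const_mul θ
  have hle (t) (ht : t ∈ Finset.Icc 1 T) : ∀ᵐ ω ∂P, θ * Q.noise lam eta t ω ≤ 1 := by
    filter_upwards [hv t ht, ae_all_iff.2 fun i ↦ hG i t ht] with ω hω hωG
    have habs := abs_clipNoise_le (Y := (Q.obs lam eta · t ω)) (hlam t ht).le hω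
      fun i ↦ (hωG i).trans (half_le_self (hlam t ht).le)
    rw [Fintype.card_fin] at habs
    exact (mul_le_mul_of_nonneg_left ((le_abs_self _).trans habs) hθ).trans (hθ1 t ht)
  simp only [ProbabilityTheory.mgf, noiseSum, Finset.mul_sum]
  have hmeas' : Measurable fun ω ↦ ∑ t ∈ Finset.Icc 1 T, θ * Q.noise lam eta t ω :=
    Finset.measurable_fun_sum _ fun t ht ↦ (hmeas t ht).mono (hpast t ht) le_rfl
  refine ⟨.of_bound hmeas'.exp.aestronglyMeasurable _ (ae_norm_exp_sum_le hle),
    integral_exp_sum_le (Q.past_mono lam eta) hmeas hle fun t ht M C hM hM0 hMC ↦ ?_⟩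
  have hvm : StronglyMeasurable[Q.past lam eta t]
      (fun ω ↦ Q.avgState lam eta t ω - Q.xstar t) :=
    ((Q.measurable_avgState_past lam eta (Finset.mem_Icc.1 ht).1).sub_const _).stronglyMeasurable
  have hstep := integral_mul_exp_clipNoise_le (θ := θ)
    ((Q.past_mono lam eta t.le_succ).trans (hpast t ht)) (hlam t ht) hp hp2 hD hθ
    (by rw [Fintype.card_fin]; exact hθ1 t ht) hM hM0 hMC hvm (hv t ht)
    fun i ↦ hnoise.heavyTailedEstimator hcosts hL ht (hG i t ht)
  rwa [Fintype.card_fin] at hstep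

end Noise

variable {N d : ℕ} {Ω : Type*} {Q : OnlineProblem N d Ω} {lam eta : ℕ → ℝ}
  {L w A BX Bg : ℝ} {B T t : ℕ} {ω ω' : Ω}

section PathLength

lemma pathLength_nonneg (Q : OnlineProblem N d Ω) (T : ℕ) : 0 ≤ Q.pathLength T :=
  Finset.sum_nonneg fun _ _ ↦ norm_nonneg _

lemma pathLength_mono (Q : OnlineProblem N d Ω) : Monotone Q.pathLength := fun _ _ hst ↦
  Finset.sum_le_sum_of_subset_of_nonneg (Finset.Icc_subset_Icc_right hst)
    fun _ _ _ ↦ norm_nonneg _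

lemma norm_xstar_le (Q : OnlineProblem N d Ω) (ht : t ∈ Finset.Icc 1 T) :
    ‖Q.xstar t‖ ≤ ‖Q.xstar 1‖ + Q.pathLength T := by
  obtain ⟨h1, hT⟩ := Finset.mem_Icc.1 ht
  exact (norm_le_norm_one_add_sum Q.xstar h1).trans
    (add_le_add_right (Q.pathLength_mono hT) _)

end PathLength

/-- The bounds of `Bounded` at a single sample point. -/
structure BoundedAt (Q : OnlineProblem N d Ω) (lam eta : ℕ → ℝ) (BX Bg : ℝ) (T : ℕ) (ω : Ω) :
    Prop where
  state_le : ∀ i, ∀ t ∈ Finset.Icc 1 T, ‖Q.state lam eta t ω i‖ ≤ BX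
  grad_state_le : ∀ i, ∀ t ∈ Finset.Icc 1 T, ‖Q.exactGrad lam eta i t ω‖ ≤ Bg
  grad_avg_le : ∀ i, ∀ t ∈ Finset.Icc 1 T, ‖gradient (Q.f i t) (Q.avgState lam eta t ω)‖ ≤ Bg

lemma Bounded.ae_boundedAt [MeasurableSpace Ω] {P : Measure Ω} (h : Q.Bounded P lam eta BX Bg T) :
    ∀ᵐ ω ∂P, Q.BoundedAt lam eta BX Bg T ω := by
  have hswap {q : Fin N → ℕ → Ω → Prop} (hq : ∀ i, ∀ t ∈ Finset.Icc 1 T, ∀ᵐ ω ∂P, q i t ω) :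
      ∀ᵐ ω ∂P, ∀ i, ∀ t ∈ Finset.Icc 1 T, q i t ω :=
    ae_all_iff.2 fun i ↦ (ae_ball_iff (Finset.Icc 1 T).countable_toSet).2 (hq i)
  filter_upwards [hswap h.state_le, hswap h.grad_state_le, hswap h.grad_avg_le]
    with ω hstate hgrad havg using ⟨hstate, hgrad, havg⟩

section Consensus

open scoped Matrix.Module

lemma norm_avgState_le (Q : OnlineProblem N d Ω) (lam eta : ℕ → ℝ) (t : ℕ) (ω : Ω) :
    ‖Q.avgState lam eta t ω‖ ≤ ‖Q.state lam eta t ω‖ := by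
  simpa [avgState] using norm_average_le (Q.state lam eta t ω)

lemma norm_state_sub_avgState_le (Q : OnlineProblem N d Ω) (lam eta : ℕ → ℝ) (t : ℕ) (ω : Ω)
    (i : Fin N) :
    ‖Q.state lam eta t ω i - Q.avgState lam eta t ω‖ ≤ ‖dev (Q.state lam eta t ω)‖ := by
  simpa [dev, avgState] using norm_le_pi_norm (dev (Q.state lam eta t ω)) i

namespace BoundedAt

lemma norm_state_le (hb : Q.BoundedAt lam eta BX Bg T ω) (hBX : 0 ≤ BX)
    (ht : t ∈ Finset.Icc 1 T) : ‖Q.state lam eta t ω‖ ≤ BX :=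
  (pi_norm_le_iff_of_nonneg hBX).2 fun i ↦ hb.state_le i t ht

lemma norm_avgState_le (hb : Q.BoundedAt lam eta BX Bg T ω) (hBX : 0 ≤ BX)
    (ht : t ∈ Finset.Icc 1 T) : ‖Q.avgState lam eta t ω‖ ≤ BX :=
  (Q.norm_avgState_le lam eta t ω).trans (hb.norm_state_le hBX ht)

lemma norm_dev_state_le (hb : Q.BoundedAt lam eta BX Bg T ω) (hBX : 0 ≤ BX)
    (ht : t ∈ Finset.Icc 1 T) : ‖dev (Q.state lam eta t ω)‖ ≤ 2 * BX :=
  (norm_dev_le _).trans (by gcongr; exact hb.norm_state_le hBX ht)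

end BoundedAt

lemma norm_state_succ_sub_le (hlam : 0 ≤ lam t) (heta : 0 ≤ eta t) (ht : 1 ≤ t) :
    ‖Q.state lam eta (t + 1) ω - Q.W t • Q.state lam eta t ω‖ ≤ eta t * lam t := by
  refine (pi_norm_le_iff_of_nonneg (mul_nonneg heta hlam)).2 fun i ↦ ?_
  rw [Pi.sub_apply, Matrix.Module.smul_apply, Q.state_succ lam eta ht, sub_sub_cancel_left,
    norm_neg, norm_smul, Real.norm_of_nonneg heta]
  exact mul_le_mul_of_nonneg_left (norm_clip_le hlam _) heta

lemma sum_norm_dev_state_le [NeZero N] (hw : 0 ≤ w) (hnet : Q.Network w B) (hBX : 0 ≤ BX)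
    (hb : Q.BoundedAt lam eta BX Bg T ω) (hlam : ∀ t, 1 ≤ t → 0 ≤ lam t)
    (heta : ∀ t, 1 ≤ t → 0 ≤ eta t) :
    N * w ^ (N * B) * ∑ t ∈ Finset.Icc 1 T, ‖dev (Q.state lam eta t ω)‖ ≤
      (N * B : ℕ) * (2 * BX) + 2 * (N * B : ℕ) * ∑ t ∈ Finset.Icc 1 T, eta t * lam t := by
  have hW (s) (hs : 1 ≤ s) : Q.W s ∈ doublyStochastic ℝ (Fin N) := hnet.doublyStochastic hw hs
  have hle : (N : ℝ) * w ^ (N * B) ≤ 1 := by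
    have htrans := transitionMatrix_mem hW (N * B)
    simpa using card_mul_le_one_of_le
      (mem_doublyStochastic_iff_mem_rowStochastic_and_mem_colStochastic.1 htrans).1
      (hnet.pow_le_transitionMatrix hw le_rfl)
  have hcontr (t) (ht : 1 ≤ t) : ‖dev (Q.state lam eta (t + N * B) ω)‖ ≤
      (1 - N * w ^ (N * B)) * ‖dev (Q.state lam eta t ω)‖
        + 2 * ∑ s ∈ Finset.range (N * B), eta (t + s) * lam (t + s) := by
    have hdev := norm_dev_add_le (fun s hs ↦ hW s (ht.trans hs))
      (x := fun s ↦ Q.state lam eta s ω) (u := fun s ↦ eta s * lam s)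
      (fun s hs ↦ norm_state_succ_sub_le (hlam s (ht.trans hs)) (heta s (ht.trans hs))
        (ht.trans hs))
      (hnet.pow_le_transitionMatrix hw ht)
    rwa [Fintype.card_fin] at hdev
  have hsum := sum_le_of_contraction (sub_nonneg.2 hle)
    (fun t ht ↦ mul_nonneg (heta t ht) (hlam t ht)) (fun _ ↦ norm_nonneg _) (by positivity)
    (fun t ht ↦ hb.norm_dev_state_le hBX ht) hcontr
  rwa [sub_sub_cancel] at hsum

end Consensus

section Regret

lemma norm_gradient_state_le (hL : 0 ≤ L) (hcosts : Q.SmoothConvexCosts L T) (hBX : 0 ≤ BX)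
    (hb : Q.BoundedAt lam eta BX Bg T ω) (ht : t ∈ Finset.Icc 1 T) (i j : Fin N) :
    ‖gradient (Q.f j t) (Q.state lam eta t ω i)‖ ≤ Bg + L * (2 * BX) := by
  set x := Q.state lam eta t ω i
  set y := Q.avgState lam eta t ω
  calc ‖gradient (Q.f j t) x‖
      ≤ ‖gradient (Q.f j t) y‖ + ‖gradient (Q.f j t) x - gradient (Q.f j t) y‖ :=
        norm_le_norm_add_norm_sub' _ _
    _ ≤ Bg + L * (2 * BX) := by
        gcongr
        · exact hb.grad_avg_le j t ht
        · refine (hcosts.smooth j t ht x y).trans (mul_le_mul_of_nonneg_left ?_ hL)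
          exact (Q.norm_state_sub_avgState_le lam eta t ω i).trans (hb.norm_dev_state_le hBX ht)

-- Convexity is used along the path from `x_i` to the average, to `x_j` and then to `z`, since the
-- gradient of `f_j` is only observed at `x_j`; each detour costs one consensus error.
lemma f_state_sub_le (hL : 0 ≤ L) (hcosts : Q.SmoothConvexCosts L T) (hBX : 0 ≤ BX)
    (hb : Q.BoundedAt lam eta BX Bg T ω) (ht : t ∈ Finset.Icc 1 T) (i j : Fin N) (z : Vec d) :
    Q.f j t (Q.state lam eta t ω i) - Q.f j t z ≤
      (3 * Bg + L * (2 * BX)) * ‖dev (Q.state lam eta t ω)‖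
      + inner ℝ (Q.exactGrad lam eta j t ω) (Q.avgState lam eta t ω - z) := by
  set m := ‖dev (Q.state lam eta t ω)‖
  set y := Q.avgState lam eta t ω
  have hdev (k) : ‖Q.state lam eta t ω k - y‖ ≤ m := Q.norm_state_sub_avgState_le lam eta t ω k
  have hinner {g u : Vec d} {c : ℝ} (hg : ‖g‖ ≤ c) (hu : ‖u‖ ≤ m) : inner ℝ g u ≤ c * m :=
    (real_inner_le_norm g u).trans
      (mul_le_mul hg hu (norm_nonneg _) ((norm_nonneg _).trans hg))
  have hconv (x z : Vec d) : Q.f j t x - Q.f j t z ≤ inner ℝ (gradient (Q.f j t) x) (x - z) :=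
    sub_le_inner_gradient (hcosts.convex j t ht) (hcosts.differentiable j t ht x) z
  have hsplit : inner ℝ (Q.exactGrad lam eta j t ω) (Q.state lam eta t ω j - z) =
      inner ℝ (Q.exactGrad lam eta j t ω) (Q.state lam eta t ω j - y)
        + inner ℝ (Q.exactGrad lam eta j t ω) (y - z) := by
    rw [← inner_add_right, sub_add_sub_cancel]
  have hown : Q.f j t (Q.state lam eta t ω j) - Q.f j t z ≤
      Bg * m + inner ℝ (Q.exactGrad lam eta j t ω) (y - z) :=
    (hconv _ z).trans (hsplit.trans_le
      (add_le_add_left (hinner (hb.grad_state_le j t ht) (hdev j)) _))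
  linarith [(hconv (Q.state lam eta t ω i) y).trans
      (hinner (norm_gradient_state_le hL hcosts hBX hb ht i j) (hdev i)),
    (hconv y (Q.state lam eta t ω j)).trans
      (hinner (hb.grad_avg_le j t ht) ((norm_sub_rev _ _).trans_le (hdev j)))]

/-- The average of the clipped gradient estimates, which drives the average state. -/
noncomputable def meanStep (Q : OnlineProblem N d Ω) (lam eta : ℕ → ℝ) (t : ℕ) (ω : Ω) : Vec d :=
  (1 / (N : ℝ)) • ∑ i, clip (lam t) (Q.obs lam eta i t ω)

lemma norm_meanStep_le (hlam : 0 ≤ lam t) : ‖Q.meanStep lam eta t ω‖ ≤ lam t := by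
  have hmean := norm_average_le fun i ↦ clip (lam t) (Q.obs lam eta i t ω)
  rw [Fintype.card_fin] at hmean
  exact hmean.trans ((pi_norm_le_iff_of_nonneg hlam).2 fun i ↦ norm_clip_le hlam _)

lemma avgState_succ (hnet : Q.Network w B) (ht : 1 ≤ t) (ω : Ω) :
    Q.avgState lam eta (t + 1) ω =
      Q.avgState lam eta t ω - eta t • Q.meanStep lam eta t ω := by
  have hmix : ∑ i, ∑ j, Q.W t i j • Q.state lam eta t ω j = ∑ j, Q.state lam eta t ω j := by
    rw [Finset.sum_comm]
    exact Finset.sum_congr rfl fun j _ ↦ by rw [← Finset.sum_smul, hnet.col_sum t ht, one_smul]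
  simp only [avgState, meanStep, Q.state_succ lam eta ht, Finset.sum_sub_distrib, hmix, smul_sub,
    ← Finset.smul_sum]
  rw [smul_comm]

lemma sum_inner_exactGrad [NeZero N] (Q : OnlineProblem N d Ω) (lam eta : ℕ → ℝ) (t : ℕ) (ω : Ω) :
    ∑ j, inner ℝ (Q.exactGrad lam eta j t ω) (Q.avgState lam eta t ω - Q.xstar t) =
      N * inner ℝ (Q.meanStep lam eta t ω) (Q.avgState lam eta t ω - Q.xstar t)
        + Q.noise lam eta t ω := by
  have hN : (N : ℝ) ≠ 0 := NeZero.ne _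
  rw [meanStep, noise, clipNoise, real_inner_smul_left, ← mul_assoc, mul_one_div_cancel hN,
    one_mul, sum_inner, ← Finset.sum_add_distrib]
  exact Finset.sum_congr rfl fun i _ ↦ by rw [← inner_add_left, add_sub_cancel]

lemma sum_inner_meanStep_le (hT : 1 ≤ T) (hBX : 0 ≤ BX) (hnet : Q.Network w B)
    (hb : Q.BoundedAt lam eta BX Bg T ω) (hlam : ∀ t, 1 ≤ t → 0 ≤ lam t)
    (heta : ∀ t, 1 ≤ t → 0 < eta t) (hanti : ∀ t, 1 ≤ t → eta (t + 1) ≤ eta t)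
    (hA : BX + eta T * lam T ≤ A) :
    ∑ t ∈ Finset.Icc 1 T,
        inner ℝ (Q.meanStep lam eta t ω) (Q.avgState lam eta t ω - Q.xstar t) ≤
      1 / eta T * (A ^ 2 / 2 + 2 * A * (‖Q.xstar 1‖ + Q.pathLength T))
        + ∑ t ∈ Finset.Icc 1 T, eta t * lam t ^ 2 / 2 := by
  have havg (t) (ht : t ∈ Finset.Icc 1 (T + 1)) : ‖Q.avgState lam eta t ω‖ ≤ A := by
    have hlast : 0 ≤ eta T * lam T := mul_nonneg (heta T hT).le (hlam T hT)
    rw [← Finset.insert_Icc_right_eq_Icc_add_one (by lia), Finset.mem_insert] at ht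
    rcases ht with rfl | ht
    · rw [avgState_succ hnet hT]
      refine (norm_sub_le _ _).trans (le_trans (add_le_add ?_ ?_) hA)
      · exact hb.norm_avgState_le hBX (Finset.mem_Icc.2 ⟨hT, le_rfl⟩)
      · rw [norm_smul, Real.norm_of_nonneg (heta T hT).le]
        exact mul_le_mul_of_nonneg_left (norm_meanStep_le (hlam T hT)) (heta T hT).le
    · exact (hb.norm_avgState_le hBX ht).trans (by linarith)
  have hstep (t) (ht : t ∈ Finset.Icc 1 T) : Q.meanStep lam eta t ω =
      (1 / eta t) • (Q.avgState lam eta t ω - Q.avgState lam eta (t + 1) ω) := by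
    have ht1 := (Finset.mem_Icc.1 ht).1
    rw [avgState_succ hnet ht1, sub_sub_cancel, smul_smul, one_div_mul_cancel (heta t ht1).ne',
      one_smul]
  refine (sum_inner_step_le hT (fun t ht ↦ one_div_pos.2 (heta t ht))
    (fun t ht ↦ one_div_le_one_div_of_le (heta _ (by lia)) (hanti t ht)) havg hstep).trans ?_
  rw [pathLength]
  refine add_le_add_right (Finset.sum_le_sum fun t ht ↦ ?_) _
  have ht1 := (Finset.mem_Icc.1 ht).1
  calc ‖Q.meanStep lam eta t ω‖ ^ 2 / (2 * (1 / eta t))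
      = eta t * ‖Q.meanStep lam eta t ω‖ ^ 2 / 2 := by
        have := (heta t ht1).ne'
        field_simp
    _ ≤ eta t * lam t ^ 2 / 2 := by
        have := (heta t ht1).le
        gcongr
        exact norm_meanStep_le (hlam t ht1)

lemma regret_le_add_noiseSum [NeZero N] (hL : 0 ≤ L) (hcosts : Q.SmoothConvexCosts L T)
    (hBX : 0 ≤ BX) (hb : Q.BoundedAt lam eta BX Bg T ω) :
    Q.regret lam eta T ω ≤ N * (N * (3 * Bg + L * (2 * BX))
        * ∑ t ∈ Finset.Icc 1 T, ‖dev (Q.state lam eta t ω)‖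
      + N * ∑ t ∈ Finset.Icc 1 T,
          inner ℝ (Q.meanStep lam eta t ω) (Q.avgState lam eta t ω - Q.xstar t)
      + Q.noiseSum lam eta T ω) := by
  have hround (i) (t) (ht : t ∈ Finset.Icc 1 T) :
      Q.cost t (Q.state lam eta t ω i) - Q.cost t (Q.xstar t) ≤
        N * (3 * Bg + L * (2 * BX)) * ‖dev (Q.state lam eta t ω)‖
        + (N * inner ℝ (Q.meanStep lam eta t ω) (Q.avgState lam eta t ω - Q.xstar t)
        + Q.noise lam eta t ω) := by
    rw [cost, cost, ← Finset.sum_sub_distrib]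
    refine (Finset.sum_le_sum fun j _ ↦ f_state_sub_le hL hcosts hBX hb ht i j _).trans_eq ?_
    rw [Finset.sum_add_distrib, sum_inner_exactGrad, Finset.sum_const, Finset.card_univ,
      Fintype.card_fin, nsmul_eq_mul, mul_assoc (N : ℝ)]
  rw [regret]
  refine (Finset.sum_le_sum fun i _ ↦ Finset.sum_le_sum (hround i)).trans_eq ?_
  simp only [Finset.sum_const, Finset.card_univ, Fintype.card_fin, nsmul_eq_mul,
    Finset.sum_add_distrib, ← Finset.mul_sum, noiseSum]
  ring

lemma regret_sub_regret_le (hL : 0 ≤ L) (hcosts : Q.SmoothConvexCosts L T) (hBX : 0 ≤ BX)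
    (hb : Q.BoundedAt lam eta BX Bg T ω) (hb' : Q.BoundedAt lam eta BX Bg T ω') :
    Q.regret lam eta T ω - Q.regret lam eta T ω' ≤
      N * (T * (N * ((Bg + L * (2 * BX)) * (2 * BX)))) := by
  simp only [regret, cost, ← Finset.sum_sub_distrib, sub_sub_sub_cancel_right]
  calc ∑ i, ∑ t ∈ Finset.Icc 1 T, ∑ j,
        (Q.f j t (Q.state lam eta t ω i) - Q.f j t (Q.state lam eta t ω' i))
      ≤ ∑ _i : Fin N, ∑ _t ∈ Finset.Icc 1 T, ∑ _j : Fin N,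
          (Bg + L * (2 * BX)) * (2 * BX) := by
        gcongr with i _ t ht j
        refine (sub_le_inner_gradient (hcosts.convex j t ht)
          (hcosts.differentiable j t ht _) _).trans ((real_inner_le_norm _ _).trans ?_)
        have hgrad := norm_gradient_state_le hL hcosts hBX hb ht i j
        have hdist := norm_sub_le_of_le (hb.state_le i t ht) (hb'.state_le i t ht)
        exact mul_le_mul hgrad (hdist.trans_eq (two_mul _).symm) (norm_nonneg _)
          ((norm_nonneg _).trans hgrad)
    _ = _ := by simp

end Regret

end OnlineProblem

section Schedules

variable {a b p α Bg : ℝ} {T t : ℕ}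

lemma rpow_add_half (α : ℝ) (ht : 1 ≤ t) : (t : ℝ) ^ (α + 1 / 2) = (t : ℝ) ^ α * √(t : ℝ) := by
  rw [Real.rpow_add (by positivity), Real.sqrt_eq_rpow]

lemma clipLevel_pos (hBg : 0 < Bg) (ht : 1 ≤ t) : 0 < clipLevel Bg α t := by
  unfold clipLevel
  positivity

lemma clipLevel_mono (hBg : 0 ≤ Bg) (hα : 0 ≤ α) : Monotone (clipLevel Bg α) := fun s t hst ↦ by
  unfold clipLevel
  gcongr

lemma le_half_clipLevel (hBg : 0 ≤ Bg) (hα : 0 ≤ α) (ht : 1 ≤ t) :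
    Bg ≤ clipLevel Bg α t / 2 := by
  rw [le_div_iff₀ two_pos, mul_comm]
  simpa [clipLevel] using clipLevel_mono hBg hα ht

lemma affine_pos (ha : 0 < a) (hab : 0 < a + b) (ht : 1 ≤ t) : 0 < a * t + b := by
  have ht' : (1 : ℝ) ≤ t := by exact_mod_cast ht
  nlinarith

lemma min_mul_le_affine (ht : 1 ≤ t) : min a (a + b) * t ≤ a * t + b := by
  have ht' : (1 : ℝ) ≤ t := by exact_mod_cast ht
  rcases le_total 0 b with hb | hb
  · nlinarith [min_le_left a (a + b)]
  · nlinarith [min_le_right a (a + b)]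

lemma affine_le_mul (ht : 1 ≤ t) : a * t + b ≤ (a + |b|) * t := by
  have ht' : (1 : ℝ) ≤ t := by exact_mod_cast ht
  nlinarith [le_abs_self b, abs_nonneg b]

lemma stepSize_pos (ha : 0 < a) (hab : 0 < a + b) {κ : ℝ} (ht : 1 ≤ t) : 0 < stepSize a b κ t :=
  one_div_pos.2 (Real.rpow_pos_of_pos (affine_pos ha hab ht) κ)

lemma stepSize_succ_le (ha : 0 < a) (hab : 0 < a + b) {κ : ℝ} (hκ : 0 ≤ κ) (ht : 1 ≤ t) :
    stepSize a b κ (t + 1) ≤ stepSize a b κ t := by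
  have hpos := affine_pos ha hab ht
  refine one_div_le_one_div_of_le (Real.rpow_pos_of_pos hpos κ) (Real.rpow_le_rpow hpos.le ?_ hκ)
  push_cast
  linarith

lemma one_div_stepSize_le (ha : 0 < a) (hab : 0 < a + b) {κ : ℝ} (hκ : 0 ≤ κ) (ht : 1 ≤ t) :
    1 / stepSize a b κ t ≤ (a + |b|) ^ κ * (t : ℝ) ^ κ := by
  rw [stepSize, one_div_one_div, ← Real.mul_rpow (by positivity) (by positivity)]
  exact Real.rpow_le_rpow (affine_pos ha hab ht).le (affine_le_mul ht) hκ

lemma stepSize_mul_clipLevel_le (ha : 0 < a) (hab : 0 < a + b) (hα : 0 ≤ α) (hBg : 0 ≤ Bg)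
    (ht : 1 ≤ t) :
    stepSize a b (α + 1 / 2) t * clipLevel Bg α t ≤
      2 * Bg / (min a (a + b)) ^ (α + 1 / 2) * (1 / √(t : ℝ)) := by
  have hmin : 0 < min a (a + b) := lt_min ha hab
  calc stepSize a b (α + 1 / 2) t * clipLevel Bg α t
      = 2 * Bg * (t : ℝ) ^ α / (a * t + b) ^ (α + 1 / 2) := by
        rw [stepSize, clipLevel, one_div_mul_eq_div]
    _ ≤ 2 * Bg * (t : ℝ) ^ α / (min a (a + b) * t) ^ (α + 1 / 2) := by
        gcongr
        exact min_mul_le_affine ht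
    _ = _ := by
        rw [Real.mul_rpow hmin.le (by positivity), rpow_add_half α ht]
        field_simp

lemma sum_stepSize_mul_clipLevel_le (ha : 0 < a) (hab : 0 < a + b) (hα : 0 ≤ α) (hBg : 0 ≤ Bg)
    (T : ℕ) :
    ∑ t ∈ Finset.Icc 1 T, stepSize a b (α + 1 / 2) t * clipLevel Bg α t ≤
      2 * Bg / (min a (a + b)) ^ (α + 1 / 2) * (2 * √(T : ℝ)) := by
  calc _ ≤ ∑ t ∈ Finset.Icc 1 T, 2 * Bg / (min a (a + b)) ^ (α + 1 / 2) * (1 / √(t : ℝ)) :=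
        Finset.sum_le_sum fun t ht ↦
          stepSize_mul_clipLevel_le ha hab hα hBg (Finset.mem_Icc.1 ht).1
    _ ≤ _ := by
        rw [← Finset.mul_sum]
        gcongr
        exact sum_one_div_sqrt_le T

lemma sum_stepSize_mul_clipLevel_sq_le (ha : 0 < a) (hab : 0 < a + b) (hα : 0 ≤ α)
    (hBg : 0 < Bg) (hT : 1 ≤ T) :
    ∑ t ∈ Finset.Icc 1 T, stepSize a b (α + 1 / 2) t * clipLevel Bg α t ^ 2 / 2 ≤
      2 * Bg / (min a (a + b)) ^ (α + 1 / 2) * (2 * Bg) * (T : ℝ) ^ (α + 1 / 2) := by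
  have hlamT : 0 ≤ clipLevel Bg α T / 2 := (half_pos (clipLevel_pos hBg hT)).le
  calc _ ≤ ∑ t ∈ Finset.Icc 1 T,
          stepSize a b (α + 1 / 2) t * clipLevel Bg α t * (clipLevel Bg α T / 2) := by
        refine Finset.sum_le_sum fun t ht ↦ ?_
        obtain ⟨ht1, htT⟩ := Finset.mem_Icc.1 ht
        have hlam := clipLevel_pos (α := α) hBg ht1
        have hstep := stepSize_pos (κ := α + 1 / 2) ha hab ht1
        rw [pow_two, ← mul_assoc, mul_div_assoc]
        gcongr
        exact clipLevel_mono hBg.le hα htT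
    _ ≤ 2 * Bg / (min a (a + b)) ^ (α + 1 / 2) * (2 * √(T : ℝ)) * (clipLevel Bg α T / 2) := by
        rw [← Finset.sum_mul]
        gcongr
        exact sum_stepSize_mul_clipLevel_le ha hab hα hBg.le T
    _ = _ := by rw [clipLevel, rpow_add_half α hT]; ring

lemma half_clipLevel_rpow_neg (hBg : 0 ≤ Bg) (hp : 0 < p) (t : ℕ) :
    (clipLevel Bg (1 / (2 * p)) t / 2) ^ (-p) = Bg ^ (-p) * (1 / √(t : ℝ)) := by
  rw [clipLevel, mul_assoc, mul_div_cancel_left₀ _ two_ne_zero, Real.mul_rpow hBg (by positivity),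
    ← Real.rpow_mul (by positivity), Real.sqrt_eq_rpow, one_div (_ ^ _),
    ← Real.rpow_neg (by positivity)]
  congr 2
  field_simp

lemma sum_noiseRate_le {n D θ : ℝ} (hn : 0 < n) (hp : 0 < p) (hBg : 0 < Bg) (hD : 0 ≤ D)
    (hθ : 0 ≤ θ) (hθ1 : ∀ t ∈ Finset.Icc 1 T, θ * (2 * n * clipLevel Bg (1 / (2 * p)) t * D) ≤ 1) :
    ∑ t ∈ Finset.Icc 1 T, noiseRate n p (clipLevel Bg (1 / (2 * p)) t) D θ ≤
      4 / n * Bg ^ (-p) * √(T : ℝ) := by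
  calc _ ≤ ∑ t ∈ Finset.Icc 1 T, 2 / n * Bg ^ (-p) * (1 / √(t : ℝ)) := by
        refine Finset.sum_le_sum fun t ht ↦ ?_
        have hrate := noiseRate_le hn hp.le (clipLevel_pos hBg (Finset.mem_Icc.1 ht).1) hD hθ
          (hθ1 t ht)
        rwa [half_clipLevel_rpow_neg hBg.le hp, ← mul_assoc] at hrate
    _ ≤ 2 / n * Bg ^ (-p) * (2 * √(T : ℝ)) := by
        rw [← Finset.mul_sum]
        gcongr
        exact sum_one_div_sqrt_le T
    _ = _ := by ring

end Schedules

namespace OnlineProblem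

section PathwiseRegret

variable {N B : ℕ} {L BX Bg w a b α : ℝ}

lemma exists_sum_norm_dev_state_le [NeZero N] (hBX : 0 ≤ BX) (hBg : 0 < Bg) (hw : 0 < w)
    (ha : 0 < a) (hab : 0 < a + b) (hα : 0 ≤ α) :
    ∃ K : ℝ, 0 ≤ K ∧ ∀ {d : ℕ} {Ω : Type*} {Q : OnlineProblem N d Ω} {T : ℕ} {ω : Ω}, 1 ≤ T →
      Q.Network w B → Q.BoundedAt (clipLevel Bg α) (stepSize a b (α + 1 / 2)) BX Bg T ω →
      ∑ t ∈ Finset.Icc 1 T, ‖dev (Q.state (clipLevel Bg α) (stepSize a b (α + 1 / 2)) t ω)‖ ≤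
        K * √(T : ℝ) := by
  have hN : 0 < (N : ℝ) := by simp [NeZero.pos]
  have hβ : 0 < N * w ^ (N * B) := by positivity
  set c := 2 * Bg / (min a (a + b)) ^ (α + 1 / 2)
  refine ⟨((N * B : ℕ) * (2 * BX) + 2 * (N * B : ℕ) * (c * 2)) / (N * w ^ (N * B)),
    by positivity, fun {d Ω Q T ω} hT hnet hb ↦ ?_⟩
  have hs : 1 ≤ √(T : ℝ) := Real.one_le_sqrt.2 (by exact_mod_cast hT)
  rw [div_mul_eq_mul_div, le_div_iff₀ hβ, mul_comm]
  calc _ ≤ (N * B : ℕ) * (2 * BX) * 1 + 2 * (N * B : ℕ) * ∑ t ∈ Finset.Icc 1 T,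
          stepSize a b (α + 1 / 2) t * clipLevel Bg α t := by
        rw [mul_one]
        exact sum_norm_dev_state_le hw.le hnet hBX hb (fun t ht ↦ (clipLevel_pos hBg ht).le)
          fun t ht ↦ (stepSize_pos ha hab ht).le
    _ ≤ (N * B : ℕ) * (2 * BX) * √(T : ℝ) + 2 * (N * B : ℕ) * (c * (2 * √(T : ℝ))) := by
        gcongr
        exact sum_stepSize_mul_clipLevel_le ha hab hα hBg.le T
    _ = _ := by ring

lemma exists_sum_inner_meanStep_le (hBX : 0 ≤ BX) (hBg : 0 < Bg) (ha : 0 < a)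
    (hab : 0 < a + b) (hα : 0 ≤ α) :
    ∃ K : ℝ, 0 ≤ K ∧ ∀ {d : ℕ} {Ω : Type*} {Q : OnlineProblem N d Ω} {T : ℕ} {ω : Ω}, 1 ≤ T →
      Q.Network w B → Q.BoundedAt (clipLevel Bg α) (stepSize a b (α + 1 / 2)) BX Bg T ω →
      ∑ t ∈ Finset.Icc 1 T, inner ℝ (Q.meanStep (clipLevel Bg α) (stepSize a b (α + 1 / 2)) t ω)
          (Q.avgState (clipLevel Bg α) (stepSize a b (α + 1 / 2)) t ω - Q.xstar t) ≤
        K * ((1 + ‖Q.xstar 1‖ + Q.pathLength T) * (T : ℝ) ^ (α + 1 / 2)) := by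
  set c := 2 * Bg / (min a (a + b)) ^ (α + 1 / 2)
  set A := BX + c
  have hc : 0 ≤ c := by positivity
  refine ⟨(a + |b|) ^ (α + 1 / 2) * (A ^ 2 / 2 + 2 * A) + c * (2 * Bg), by positivity,
    fun {d Ω Q T ω} hT hnet hb ↦ ?_⟩
  have hlast : stepSize a b (α + 1 / 2) T * clipLevel Bg α T ≤ c :=
    (stepSize_mul_clipLevel_le ha hab hα hBg.le hT).trans <| mul_le_of_le_one_right hc <|
      div_le_one_of_le₀ (Real.one_le_sqrt.2 (by exact_mod_cast hT)) (Real.sqrt_nonneg _)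
  have hpath := Q.pathLength_nonneg T
  set F := 1 + ‖Q.xstar 1‖ + Q.pathLength T
  have hF1 : 1 ≤ F := by linarith [norm_nonneg (Q.xstar 1)]
  calc _ ≤ 1 / stepSize a b (α + 1 / 2) T
          * (A ^ 2 / 2 + 2 * A * (‖Q.xstar 1‖ + Q.pathLength T))
        + ∑ t ∈ Finset.Icc 1 T, stepSize a b (α + 1 / 2) t * clipLevel Bg α t ^ 2 / 2 :=
        sum_inner_meanStep_le hT hBX hnet hb (fun t ht ↦ (clipLevel_pos hBg ht).le)
          (fun t ht ↦ stepSize_pos ha hab ht)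
          (fun t ht ↦ stepSize_succ_le ha hab (by positivity) ht) (add_le_add_right hlast BX)
    _ ≤ (a + |b|) ^ (α + 1 / 2) * (T : ℝ) ^ (α + 1 / 2) * (A ^ 2 / 2 * F + 2 * A * F)
        + c * (2 * Bg) * (F * (T : ℝ) ^ (α + 1 / 2)) := by
        gcongr
        · exact one_div_stepSize_le ha hab (by positivity) hT
        · exact le_mul_of_one_le_right (by positivity) hF1
        · linarith
        · refine (sum_stepSize_mul_clipLevel_sq_le ha hab hα hBg hT).trans ?_
          gcongr
          exact le_mul_of_one_le_left (by positivity) hF1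
    _ = _ := by ring

lemma exists_regret_le_add_noiseSum [NeZero N] (hL : 0 ≤ L) (hBX : 0 ≤ BX) (hBg : 0 < Bg)
    (hw : 0 < w) (ha : 0 < a) (hab : 0 < a + b) (hα : 0 ≤ α) :
    ∃ K : ℝ, 0 ≤ K ∧ ∀ {d : ℕ} {Ω : Type*} {Q : OnlineProblem N d Ω} {T : ℕ} {ω : Ω}, 1 ≤ T →
      Q.Network w B → Q.SmoothConvexCosts L T →
      Q.BoundedAt (clipLevel Bg α) (stepSize a b (α + 1 / 2)) BX Bg T ω →
      Q.regret (clipLevel Bg α) (stepSize a b (α + 1 / 2)) T ω ≤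
        K * ((1 + ‖Q.xstar 1‖ + Q.pathLength T) * (T : ℝ) ^ (α + 1 / 2))
          + N * Q.noiseSum (clipLevel Bg α) (stepSize a b (α + 1 / 2)) T ω := by
  obtain ⟨K₁, hK₁, hdev⟩ :=
    exists_sum_norm_dev_state_le (N := N) (B := B) hBX hBg hw ha hab hα
  obtain ⟨K₂, hK₂, hstep⟩ :=
    exists_sum_inner_meanStep_le (N := N) (B := B) (w := w) hBX hBg ha hab hα
  refine ⟨N * (N * (3 * Bg + L * (2 * BX)) * K₁ + N * K₂), by positivity,
    fun {d Ω Q T ω} hT hnet hcosts hb ↦ ?_⟩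
  have hT1 : (1 : ℝ) ≤ T := by exact_mod_cast hT
  have hF : 1 ≤ 1 + ‖Q.xstar 1‖ + Q.pathLength T := by
    linarith [norm_nonneg (Q.xstar 1), Q.pathLength_nonneg T]
  have hsqrt : √(T : ℝ) ≤ (1 + ‖Q.xstar 1‖ + Q.pathLength T) * (T : ℝ) ^ (α + 1 / 2) := by
    rw [rpow_add_half α hT]
    exact (le_mul_of_one_le_left (Real.sqrt_nonneg _) (Real.one_le_rpow hT1 hα)).trans
      (le_mul_of_one_le_left (by positivity) hF)
  refine (regret_le_add_noiseSum hL hcosts hBX hb).trans ?_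
  rw [mul_add]
  refine add_le_add ?_ le_rfl
  calc _ ≤ (N : ℝ) * (N * (3 * Bg + L * (2 * BX))
          * (K₁ * ((1 + ‖Q.xstar 1‖ + Q.pathLength T) * (T : ℝ) ^ (α + 1 / 2)))
        + N * (K₂ * ((1 + ‖Q.xstar 1‖ + Q.pathLength T) * (T : ℝ) ^ (α + 1 / 2)))) := by
        gcongr
        · exact (hdev hT hnet hb).trans (by gcongr)
        · exact hstep hT hnet hb
    _ = _ := by ring

end PathwiseRegret

/-- The assumptions of `ConvexSetting` with arbitrary comparators: `xstar t` need not minimize the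
global cost. -/
structure ComparatorSetting {N d : ℕ} {Ω : Type*} [MeasurableSpace Ω] (Q : OnlineProblem N d Ω)
    (P : Measure Ω) (lam eta : ℕ → ℝ) (p σ L BX Bg w : ℝ) (B T : ℕ) : Prop where
  network : Q.Network w B
  costs : Q.SmoothConvexCosts L T
  noise : Q.HeavyTailedNoise P lam eta p σ T
  bounded : Q.Bounded P lam eta BX Bg T

lemma ConvexSetting.comparatorSetting {N d : ℕ} {Ω : Type*} [MeasurableSpace Ω]
    {Q : OnlineProblem N d Ω} {P : Measure Ω} {lam eta : ℕ → ℝ} {p σ L BX Bg w : ℝ} {B T : ℕ}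
    (h : Q.ConvexSetting P lam eta p σ L BX Bg w B T) :
    Q.ComparatorSetting P lam eta p σ L BX Bg w B T where
  network := h.network
  costs := ⟨h.costs.convex, h.costs.differentiable, h.costs.smooth⟩
  noise := h.noise
  bounded := h.bounded

section NoiseTail

variable {N d B T : ℕ} {Ω : Type*} [MeasurableSpace Ω] {P : Measure Ω} [IsProbabilityMeasure P]
  {Q : OnlineProblem N d Ω} {p σ L BX Bg w D δ : ℝ} {eta : ℕ → ℝ}

lemma measure_noiseSum_ge_le [NeZero N] (hT : 1 ≤ T) (hp : 1 ≤ p) (hp2 : p ≤ 2) (hσ : 0 ≤ σ)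
    (hL : 0 ≤ L) (hBX : 0 ≤ BX) (hBg : 0 < Bg)
    (hQ : Q.ComparatorSetting P (clipLevel Bg (1 / (2 * p))) eta p σ L BX Bg w B T)
    (hD : 0 < D) (hpath : BX + ‖Q.xstar 1‖ + Q.pathLength T ≤ D) (hδ : 0 < δ) :
    P {ω | 4 * N * Bg * D * ((T : ℝ) ^ (1 / (2 * p))
        * (4 * (Bg ^ (-p) * σ ^ p) * √(T : ℝ) + Real.log (1 / δ))) ≤
      Q.noiseSum (clipLevel Bg (1 / (2 * p))) eta T ω} ≤ ENNReal.ofReal δ := by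
  have hα : 0 ≤ 1 / (2 * p) := by positivity
  have hN : 0 < (N : ℝ) := by simp [NeZero.pos]
  have hlam := clipLevel_pos (α := 1 / (2 * p)) hBg hT
  set θ := 1 / (2 * N * clipLevel Bg (1 / (2 * p)) T * D) with hθ
  have hθ0 : 0 < θ := by positivity
  have hθ1 (t) (ht : t ∈ Finset.Icc 1 T) :
      θ * (2 * N * clipLevel Bg (1 / (2 * p)) t * D) ≤ 1 := by
    rw [hθ, one_div_mul_eq_div]
    refine div_le_one_of_le₀ ?_ (by positivity)
    gcongr
    exact clipLevel_mono hBg.le hα (Finset.mem_Icc.1 ht).2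
  have hb := hQ.bounded.ae_boundedAt
  obtain ⟨hint, hmgf⟩ := mgf_noiseSum_le (D := D) (θ := θ) hQ.noise hQ.costs hL hp hp2 hD.le hθ0.le
    (fun t ht ↦ clipLevel_pos hBg (Finset.mem_Icc.1 ht).1) hθ1
    (fun i t ht ↦ hb.mono fun ω hω ↦
      (hω.grad_state_le i t ht).trans (le_half_clipLevel hBg.le hα (Finset.mem_Icc.1 ht).1))
    (fun t ht ↦ hb.mono fun ω hω ↦
      (norm_sub_le_of_le (hω.norm_avgState_le hBX ht) (Q.norm_xstar_le ht)).trans (by linarith))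
  have hrate : ∑ t ∈ Finset.Icc 1 T,
      noiseRate N p (clipLevel Bg (1 / (2 * p)) t) D θ * (N * σ ^ p) ≤
        4 * (Bg ^ (-p) * σ ^ p) * √(T : ℝ) := by
    rw [← Finset.sum_mul]
    calc _ ≤ 4 / N * Bg ^ (-p) * √(T : ℝ) * (N * σ ^ p) := by
          gcongr
          exact sum_noiseRate_le hN (by positivity) hBg hD.le hθ0.le hθ1
      _ = _ := by field_simp
  convert measure_ge_le_of_mgf_le hθ0 hδ hint (hmgf.trans (Real.exp_le_exp.2 hrate)) using 5
  rw [hθ, div_div_eq_mul_div, div_one, clipLevel]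
  ring

end NoiseTail

end OnlineProblem

section Probability

variable {Ω : Type*} [MeasurableSpace Ω] {P : Measure Ω} {X : Ω → ℝ} {c δ : ℝ}

lemma ofReal_one_sub_le_measure_lt [IsProbabilityMeasure P] (hδ : 0 ≤ δ)
    (h : P {ω | c ≤ X ω} ≤ ENNReal.ofReal δ) : ENNReal.ofReal (1 - δ) ≤ P {ω | X ω < c} := by
  rw [ENNReal.ofReal_sub _ hδ, ENNReal.ofReal_one, tsub_le_iff_right]
  calc (1 : ENNReal) = P Set.univ := measure_univ.symm
    _ ≤ P {ω | X ω < c} + P {ω | X ω < c}ᶜ := measure_univ_le_add_compl _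
    _ ≤ P {ω | X ω < c} + ENNReal.ofReal δ := by
        gcongr
        simpa only [Set.compl_ofPred, not_lt] using h

lemma ae_le_add_of_sub_le {q : Ω → Prop} {K : ℝ} (hq : ∀ᵐ ω ∂P, q ω)
    (hX : ∀ {ω ω'}, q ω → q ω' → X ω - X ω' ≤ K) (hc : P {ω | X ω ≤ c} ≠ 0) :
    ∀ᵐ ω ∂P, X ω ≤ c + K := by
  obtain ⟨ω', hcω', hqω'⟩ := ((frequently_ae_iff.2 hc).and_eventually hq).exists
  filter_upwards [hq] with ω hω
  linarith [hX hω hqω']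

end Probability

section HighProbability

variable {N B : ℕ} {p σ L BX Bg w a b : ℝ}

open OnlineProblem

lemma exists_regret_bound_mul_log [NeZero N] (hp : 1 ≤ p) (hp2 : p ≤ 2) (hσ : 0 ≤ σ) (hL : 0 ≤ L)
    (hBX : 0 ≤ BX) (hBg : 0 < Bg) (hw : 0 < w) (ha : 0 < a) (hab : 0 < a + b) :
    ∃ C : ℝ, 0 < C ∧ ∀ {d : ℕ} {Ω : Type*} [MeasurableSpace Ω] {P : Measure Ω}
      [IsProbabilityMeasure P] {Q : OnlineProblem N d Ω} {T : ℕ}, 1 ≤ T →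
      Q.ComparatorSetting P (clipLevel Bg (1 / (2 * p))) (stepSize a b (1 / (2 * p) + 1 / 2))
        p σ L BX Bg w B T →
      ∀ {δ : ℝ}, 0 < δ → δ ≤ 1 → ENNReal.ofReal (1 - δ) ≤
        P {ω | Q.regret (clipLevel Bg (1 / (2 * p))) (stepSize a b (1 / (2 * p) + 1 / 2)) T ω ≤
          C * ((1 + ‖Q.xstar 1‖ + Q.pathLength T)
            * ((T : ℝ) ^ (1 / (2 * p)) * (√(T : ℝ) + Real.log (1 / δ))))} := by
  obtain ⟨K, hK, hregret⟩ := exists_regret_le_add_noiseSum (N := N) (B := B) (α := 1 / (2 * p)) hL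
    hBX hBg hw ha hab (by positivity)
  have hN : 0 < (N : ℝ) := by simp [NeZero.pos]
  set s := 4 * (Bg ^ (-p) * σ ^ p)
  refine ⟨K + N * (4 * N * Bg * (1 + BX) * (s + 1)), by positivity,
    fun {d Ω _ P _ Q T} hT hQ {δ} hδ hδ1 ↦ ?_⟩
  have hlog : 0 ≤ Real.log (1 / δ) := Real.log_nonneg ((one_le_div hδ).2 hδ1)
  have hpath := Q.pathLength_nonneg T
  set F := 1 + ‖Q.xstar 1‖ + Q.pathLength T
  set U := (T : ℝ) ^ (1 / (2 * p)) * (√(T : ℝ) + Real.log (1 / δ)) with hU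
  have hD : BX + ‖Q.xstar 1‖ + Q.pathLength T ≤ (1 + BX) * F := by
    nlinarith [norm_nonneg (Q.xstar 1)]
  have htail := measure_noiseSum_ge_le hT hp hp2 hσ hL hBX hBg hQ (by positivity) hD hδ
  refine (ofReal_one_sub_le_measure_lt hδ.le htail).trans (measure_mono_ae ?_)
  filter_upwards [hQ.bounded.ae_boundedAt] with ω hω (hnoise : _ < _)
  calc _ ≤ K * (F * (T : ℝ) ^ (1 / (2 * p) + 1 / 2)) + N * _ :=
        hregret hT hQ.network hQ.costs hω
    _ ≤ K * (F * U) + N * (4 * N * Bg * ((1 + BX) * F) * ((s + 1) * U)) := by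
        gcongr
        · rw [rpow_add_half _ hT, hU]
          gcongr
          exact le_add_of_nonneg_right hlog
        · refine hnoise.le.trans ?_
          rw [hU, mul_left_comm (s + 1)]
          gcongr
          have hs : 0 ≤ s * Real.log (1 / δ) := by positivity
          linarith [Real.sqrt_nonneg (T : ℝ)]
    _ = _ := by ring

end HighProbability

lemma OnlineProblem.Bounded.norm_xstar_one_le {N d T : ℕ} {Ω : Type*} [MeasurableSpace Ω]
    {P : Measure Ω} [IsProbabilityMeasure P] {Q : OnlineProblem N d Ω} {lam eta : ℕ → ℝ}
    {BX Bg R : ℝ} [NeZero N] (hb : Q.Bounded P lam eta BX Bg T) (hT : 1 ≤ T)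
    (hinit : ∀ i, ‖Q.init i - Q.xstar 1‖ ≤ R) : ‖Q.xstar 1‖ ≤ BX + R := by
  obtain ⟨_, hstate⟩ := (hb.state_le 0 1 (Finset.left_mem_Icc.2 hT)).exists
  calc ‖Q.xstar 1‖ = ‖Q.init 0 - (Q.init 0 - Q.xstar 1)‖ := by rw [sub_sub_cancel]
    _ ≤ BX + R := norm_sub_le_of_le hstate (hinit 0)

section RegretBound

open OnlineProblem

variable {N B : ℕ} {p σ L BX Bg w a b : ℝ}

lemma exists_regret_bound_of_log_le [NeZero N] (hp : 1 ≤ p) (hp2 : p ≤ 2) (hσ : 0 ≤ σ) (hL : 0 ≤ L)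
    (hBX : 0 ≤ BX) (hBg : 0 < Bg) (hw : 0 < w) (ha : 0 < a) (hab : 0 < a + b) (R : ℝ) :
    ∃ C : ℝ, 0 < C ∧ ∀ {d : ℕ} {Ω : Type*} [MeasurableSpace Ω] {P : Measure Ω}
      [IsProbabilityMeasure P] {Q : OnlineProblem N d Ω} {T : ℕ}, 1 ≤ T →
      Q.ComparatorSetting P (clipLevel Bg (1 / (2 * p))) (stepSize a b (1 / (2 * p) + 1 / 2))
        p σ L BX Bg w B T →
      (∀ i, ‖Q.init i - Q.xstar 1‖ ≤ R) →
      ∀ {δ : ℝ}, 0 < δ → δ ≤ 1 → Real.log (1 / δ) ≤ √(T : ℝ) → ENNReal.ofReal (1 - δ) ≤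
        P {ω | Q.regret (clipLevel Bg (1 / (2 * p))) (stepSize a b (1 / (2 * p) + 1 / 2)) T ω ≤
          C * ((1 + Q.pathLength T) * (T : ℝ) ^ (1 / (2 * p) + 1 / 2))} := by
  obtain ⟨C, hC, hregret⟩ := exists_regret_bound_mul_log (N := N) (B := B) hp hp2 hσ hL hBX hBg hw
    ha hab
  refine ⟨C * ((1 + BX + |R|) * 2), by positivity,
    fun {d Ω _ P _ Q T} hT hQ hinit {δ} hδ hδ1 hlog ↦
      (hregret hT hQ hδ hδ1).trans <| measure_mono <|
        Set.ofPred_subset_ofPred.2 fun ω hω ↦ hω.trans ?_⟩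
  have hlog0 : 0 ≤ Real.log (1 / δ) := Real.log_nonneg ((one_le_div hδ).2 hδ1)
  have hpath := Q.pathLength_nonneg T
  have hF : 1 + ‖Q.xstar 1‖ + Q.pathLength T ≤ (1 + BX + |R|) * (1 + Q.pathLength T) := by
    nlinarith [hQ.bounded.norm_xstar_one_le hT hinit, le_abs_self R, abs_nonneg R]
  calc _ ≤ C * ((1 + BX + |R|) * (1 + Q.pathLength T)
          * ((T : ℝ) ^ (1 / (2 * p)) * (√(T : ℝ) + √(T : ℝ)))) := by gcongr
    _ = _ := by rw [rpow_add_half _ hT]; ring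

lemma exists_ae_regret_le [NeZero N] (hp : 1 ≤ p) (hp2 : p ≤ 2) (hσ : 0 ≤ σ) (hL : 0 ≤ L)
    (hBX : 0 ≤ BX) (hBg : 0 < Bg) (hw : 0 < w) (ha : 0 < a) (hab : 0 < a + b) (R : ℝ) :
    ∃ C : ℝ, 0 < C ∧ ∀ {d : ℕ} {Ω : Type*} [MeasurableSpace Ω] {P : Measure Ω}
      [IsProbabilityMeasure P] {Q : OnlineProblem N d Ω} {T : ℕ}, 1 ≤ T →
      Q.ComparatorSetting P (clipLevel Bg (1 / (2 * p))) (stepSize a b (1 / (2 * p) + 1 / 2))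
        p σ L BX Bg w B T →
      (∀ i, ‖Q.init i - Q.xstar 1‖ ≤ R) →
      ∀ᵐ ω ∂P,
        Q.regret (clipLevel Bg (1 / (2 * p))) (stepSize a b (1 / (2 * p) + 1 / 2)) T ω ≤
          C * ((1 + Q.pathLength T) * (T : ℝ) ^ (1 / (2 * p) + 1 / 2) + T) := by
  obtain ⟨C, hC, hregret⟩ := exists_regret_bound_of_log_le (N := N) (B := B) hp hp2 hσ hL hBX hBg
    hw ha hab R
  set K := N * (N * ((Bg + L * (2 * BX)) * (2 * BX)))
  refine ⟨C + K, by positivity, fun {d Ω _ P _ Q T} hT hQ hinit ↦ ?_⟩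
  have hlog : Real.log (1 / (1 / 2)) ≤ √(T : ℝ) := by
    have hs : 1 ≤ √(T : ℝ) := Real.one_le_sqrt.2 (by exact_mod_cast hT)
    norm_num1
    linarith [Real.log_two_lt_d9]
  have hhalf := hregret hT hQ hinit one_half_pos one_half_lt_one.le hlog
  have hpos := (ENNReal.ofReal_pos.2 (by norm_num)).trans_le hhalf
  filter_upwards [ae_le_add_of_sub_le hQ.bounded.ae_boundedAt
    (regret_sub_regret_le hL hQ.costs hBX) hpos.ne'] with ω hω
  have hpath := Q.pathLength_nonneg T
  set V := (1 + Q.pathLength T) * (T : ℝ) ^ (1 / (2 * p) + 1 / 2)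
  have hKV : 0 ≤ K * V := by positivity
  have hCT : 0 ≤ C * T := by positivity
  calc _ ≤ C * V + K * T := hω.trans_eq (by ring)
    _ ≤ (C + K) * (V + T) := by linarith

lemma exists_regret_bound [NeZero N] (hp : 1 ≤ p) (hp2 : p ≤ 2) (hσ : 0 ≤ σ) (hL : 0 ≤ L)
    (hBX : 0 ≤ BX) (hBg : 0 < Bg) (hw : 0 < w) (ha : 0 < a) (hab : 0 < a + b) (R : ℝ) :
    ∃ C : ℝ, 0 < C ∧ ∀ {d : ℕ} {Ω : Type*} [MeasurableSpace Ω] {P : Measure Ω}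
      [IsProbabilityMeasure P] {Q : OnlineProblem N d Ω} {T : ℕ}, 1 ≤ T →
      Q.ComparatorSetting P (clipLevel Bg (1 / (2 * p))) (stepSize a b ((p + 1) / (2 * p)))
        p σ L BX Bg w B T →
      (∀ i, ‖Q.init i - Q.xstar 1‖ ≤ R) →
      ∀ {δ : ℝ}, 0 < δ → δ ≤ 1 → ENNReal.ofReal (1 - δ) ≤
        P {ω | Q.regret (clipLevel Bg (1 / (2 * p))) (stepSize a b ((p + 1) / (2 * p))) T ω ≤
          C * ((T : ℝ) ^ ((1 + p) / (2 * p)) * (1 + Q.pathLength T + Real.log (1 / δ)))} := by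
  have hκ : (p + 1) / (2 * p) = 1 / (2 * p) + 1 / 2 := by field_simp; ring
  rw [add_comm 1 p, hκ]
  obtain ⟨C₁, hC₁, hsmall⟩ := exists_regret_bound_of_log_le (N := N) (B := B) hp hp2 hσ hL hBX hBg
    hw ha hab R
  obtain ⟨C₂, hC₂, hlarge⟩ := exists_ae_regret_le (N := N) (B := B) hp hp2 hσ hL hBX hBg hw ha hab R
  refine ⟨C₁ + C₂, by positivity, fun {d Ω _ P _ Q T} hT hQ hinit {δ} hδ hδ1 ↦ ?_⟩
  have hlog : 0 ≤ Real.log (1 / δ) := Real.log_nonneg ((one_le_div hδ).2 hδ1)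
  have hpath := Q.pathLength_nonneg T
  set V := (T : ℝ) ^ (1 / (2 * p) + 1 / 2) with hV
  rcases le_total (Real.log (1 / δ)) √(T : ℝ) with hle | hge
  · refine (hsmall hT hQ hinit hδ hδ1 hle).trans <| measure_mono <|
      Set.ofPred_subset_ofPred.2 fun ω hω ↦ hω.trans ?_
    rw [mul_comm (1 + Q.pathLength T)]
    gcongr ?_ * (_ * ?_)
    · exact le_add_of_nonneg_right hC₂.le
    · exact le_add_of_nonneg_right hlog
  · have hTV : (T : ℝ) ≤ V * Real.log (1 / δ) := by
      calc (T : ℝ) = √(T : ℝ) * √(T : ℝ) := (Real.mul_self_sqrt T.cast_nonneg).symm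
        _ ≤ V * Real.log (1 / δ) := by
          gcongr
          rw [hV, rpow_add_half _ hT]
          exact le_mul_of_one_le_left (Real.sqrt_nonneg _)
            (Real.one_le_rpow (by exact_mod_cast hT) (by positivity))
    calc ENNReal.ofReal (1 - δ) ≤ P Set.univ := by
          rw [measure_univ]
          exact ENNReal.ofReal_le_one.2 (by linarith)
      _ ≤ _ := measure_mono_ae <| (hlarge hT hQ hinit).mono fun ω hω _ ↦ hω.trans ?_
    calc C₂ * ((1 + Q.pathLength T) * V + T)
        ≤ (C₁ + C₂) * ((1 + Q.pathLength T) * V + V * Real.log (1 / δ)) := by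
          gcongr
          exact le_add_of_nonneg_left hC₁.le
      _ = _ := by ring

lemma tendsto_regretBound_div {C l : ℝ} {c : ℕ → ℝ} (hp : 1 < p)
    (hc : Tendsto (fun T : ℕ ↦ c T / (T : ℝ) ^ ((p - 1) / (2 * p))) atTop (𝓝 0)) :
    Tendsto (fun T : ℕ ↦ C * ((T : ℝ) ^ ((1 + p) / (2 * p)) * (1 + c T + l)) / (T : ℝ))
      atTop (𝓝 0) := by
  have hγ : 0 < (p - 1) / (2 * p) := div_pos (by linarith) (by linarith)
  have hconst : Tendsto (fun T : ℕ ↦ (1 + l) / (T : ℝ) ^ ((p - 1) / (2 * p))) atTop (𝓝 0) :=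
    tendsto_const_nhds.div_atTop ((tendsto_rpow_atTop hγ).comp tendsto_natCast_atTop_atTop)
  have hsum := (hc.add hconst).const_mul C
  rw [add_zero, mul_zero] at hsum
  refine hsum.congr' ?_
  filter_upwards [eventually_ge_atTop 1] with T hT
  have hT0 : (0 : ℝ) < T := by exact_mod_cast hT
  have hexp : (T : ℝ) ^ ((1 + p) / (2 * p)) * (T : ℝ) ^ ((p - 1) / (2 * p)) = T := by
    rw [← Real.rpow_add hT0, ← add_div, show 1 + p + (p - 1) = 2 * p by ring,
      div_self (by positivity), Real.rpow_one]
  rw [← add_div, ← mul_div_assoc, div_eq_div_iff (by positivity) hT0.ne']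
  linear_combination -(C * (1 + c T + l)) * hexp

end RegretBound

end ODCSGD

theorem corollary1_general (N B : ℕ) (hN : 1 ≤ N)
    (p σ L BX Bg w a b R : ℝ)
    (hp : 1 < p) (hp2 : p ≤ 2) (hσ : 0 ≤ σ) (hL : 0 ≤ L) (hBX : 0 ≤ BX) (hBg : 0 < Bg)
    (hw : 0 < w) (ha : 0 < a) (hab : 0 < a + b)
    (lam eta : ℕ → ℝ)
    (hlam : lam = ODCSGD.clipLevel Bg (1 / (2 * p)))
    (heta : eta = ODCSGD.stepSize a b ((p + 1) / (2 * p))) :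
    (∃ C : ℝ, 0 < C ∧
      ∀ (d : ℕ) (Ω : Type*) [MeasurableSpace Ω] (P : Measure Ω) [IsProbabilityMeasure P]
        (Q : ODCSGD.OnlineProblem N d Ω) (T : ℕ), 1 ≤ T →
        Q.ComparatorSetting P lam eta p σ L BX Bg w B T →
        (∀ i, ‖Q.init i - Q.xstar 1‖ ≤ R) →
        ∀ δ : ℝ, 0 < δ → δ < 1 →
          ENNReal.ofReal (1 - δ) ≤
            P {ω | Q.regret lam eta T ω ≤
              C * ((T : ℝ) ^ ((1 + p) / (2 * p)) * (1 + Q.pathLength T + Real.log (1 / δ)))})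
    ∧
    (∀ (d : ℕ) (Ω : Type*) [MeasurableSpace Ω] (P : Measure Ω) [IsProbabilityMeasure P]
        (Q : ODCSGD.OnlineProblem N d Ω),
        (∀ T : ℕ, 1 ≤ T → Q.ComparatorSetting P lam eta p σ L BX Bg w B T) →
        Tendsto (fun T : ℕ ↦ Q.pathLength T / (T : ℝ) ^ ((p - 1) / (2 * p))) atTop (𝓝 0) →
        ∀ δ : ℝ, 0 < δ → δ < 1 →
          ∃ bound : ℕ → ℝ, Tendsto (fun T : ℕ ↦ bound T / (T : ℝ)) atTop (𝓝 0) ∧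
            ∀ T : ℕ, 1 ≤ T →
              ENNReal.ofReal (1 - δ) ≤ P {ω | Q.regret lam eta T ω ≤ bound T}) := by
  have : NeZero N := ⟨by lia⟩
  subst hlam heta
  constructor
  · obtain ⟨C, hC, hregret⟩ := ODCSGD.exists_regret_bound (N := N) (B := B) hp.le hp2 hσ hL hBX hBg
      hw ha hab R
    exact ⟨C, hC, fun d Ω _ P _ Q T hT hQ hinit δ hδ hδ1 ↦ hregret hT hQ hinit hδ hδ1.le⟩
  · intro d Ω _ P _ Q hQ hpath δ hδ hδ1
    obtain ⟨C, -, hregret⟩ := ODCSGD.exists_regret_bound (N := N) (B := B) hp.le hp2 hσ hL hBX hBg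
      hw ha hab (∑ i, ‖Q.init i - Q.xstar 1‖)
    have hinit (i) : ‖Q.init i - Q.xstar 1‖ ≤ ∑ j, ‖Q.init j - Q.xstar 1‖ :=
      Finset.single_le_sum (f := fun j ↦ ‖Q.init j - Q.xstar 1‖) (fun j _ ↦ norm_nonneg _)
        (Finset.mem_univ i)
    exact ⟨_, ODCSGD.tendsto_regretBound_div hp hpath,
      fun T hT ↦ hregret hT (hQ T hT) hinit hδ hδ1.le⟩

theorem corollary1 (N B : ℕ) (hN : 1 ≤ N) (hB : 1 ≤ B)
    (p σ L BX Bg w a b R : ℝ)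
    (hp : 1 < p) (hp2 : p ≤ 2) (hσ : 0 < σ) (hL : 0 ≤ L) (hBX : 0 < BX) (hBg : 0 < Bg)
    (hw : 0 < w) (hw1 : w < 1) (ha : 0 < a) (hab : 0 < a + b)
    (lam eta : ℕ → ℝ)
    (hlam : lam = ODCSGD.clipLevel Bg (1 / (2 * p)))
    (heta : eta = ODCSGD.stepSize a b ((p + 1) / (2 * p))) :
    -- the high-probability regret bound, with a constant that depends on the parameters above only
    (∃ C : ℝ, 0 < C ∧
      ∀ (d : ℕ) (Ω : Type*) [MeasurableSpace Ω] (P : Measure Ω) [IsProbabilityMeasure P]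
        (Q : ODCSGD.OnlineProblem N d Ω) (T : ℕ), 1 ≤ T →
        Q.ConvexSetting P lam eta p σ L BX Bg w B T →
        (∀ i, ‖Q.init i - Q.xstar 1‖ ≤ R) →
        ∀ δ : ℝ, 0 < δ → δ < 1 →
          ENNReal.ofReal (1 - δ) ≤
            P {ω | Q.regret lam eta T ω ≤
              C * ((T : ℝ) ^ ((1 + p) / (2 * p)) * (1 + Q.pathLength T + Real.log (1 / δ)))})
    ∧
    -- sublinear regret with high probability, if `C_T = o(T^((p-1)/(2p)))`
    (∀ (d : ℕ) (Ω : Type*) [MeasurableSpace Ω] (P : Measure Ω) [IsProbabilityMeasure P]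
        (Q : ODCSGD.OnlineProblem N d Ω),
        (∀ T : ℕ, 1 ≤ T → Q.ConvexSetting P lam eta p σ L BX Bg w B T) →
        Tendsto (fun T : ℕ => Q.pathLength T / (T : ℝ) ^ ((p - 1) / (2 * p))) atTop (𝓝 0) →
        ∀ δ : ℝ, 0 < δ → δ < 1 →
          ∃ bound : ℕ → ℝ, Tendsto (fun T : ℕ => bound T / (T : ℝ)) atTop (𝓝 0) ∧
            ∀ T : ℕ, 1 ≤ T →
              ENNReal.ofReal (1 - δ) ≤ P {ω | Q.regret lam eta T ω ≤ bound T}) := by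
  obtain ⟨hbound, hsublinear⟩ := corollary1_general N B hN p σ L BX Bg w a b R hp hp2 hσ.le hL
    hBX.le hBg hw ha hab lam eta hlam heta
  exact ⟨hbound.imp fun C ⟨hC, h⟩ ↦ ⟨hC, fun d Ω _ P _ Q T hT hQ ↦ h d Ω P Q T hT
    hQ.comparatorSetting⟩, fun d Ω _ P _ Q hQ ↦ hsublinear d Ω P Q fun T hT ↦
    (hQ T hT).comparatorSetting⟩
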